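/- Fix $k>0$ and $\mu\in(0,1)$. Consider the following game between two senders and a receiver $R$. The types $\omega_1,\omega_2\in\{0,1\}$ of the senders are independent with $\Pr(\omega_i=1)=\mu$. First, each sender $i$ simultaneously commits to a distribution of posterior beliefs, a Borel probability measure $p_i$ on $[0,1]$ with mean $\mu$. Without observing $p_1,p_2$, $R$ either visits nobody (and selects one of the senders with any probabilities) or visits a sender first; she may randomize over which one. On visiting the first sender $i$ she observes $p_i$, chooses a garbling $q_i$ of $p_i$ (a distribution with mean $\mu$ that second-order stochastically dominates $p_i$), pays $\int k(x-\mu)^2\,dq_i(x)$, and draws a belief $x$ from $q_i$. Depending on $x$, she either stops (her belief about the other sender $j$ then being $\mu$) or visits $j$, observes $p_j$, chooses a garbling $q_j$ of $p_j$ depending on $x$ and $p_j$, pays $\int k(y-\mu)^2\,dq_j(y)$, and draws a belief $y$ from $q_j$. She selects the sender about whom her belief is higher, ties being broken in any way. $R$'s payoff is the expected type of the selected sender minus attention costs; a sender's payoff is the probability that he is selected. Except for the order of visits and the breaking of ties, strategies are pure. An equilibrium is a profile in which each sender's offer is a best response and $R$ acts optimally at every decision node, on and off path, where she expects a sender whom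 she has not yet visited to offer his equilibrium distribution. $R$'s first-best payoff is the supremum of her expected payoff over all pairs of offers $(p_1,p_2)$ and all her strategies. A sender offers full information if his posterior is $1$ with probability $\mu$ and $0$ with probability $1-\mu$. Claim (First best). For every $k>0$ and $\mu\in(0,1)$, there is an equilibrium that gives $R$ her first-best payoff if and only if there is an equilibrium in which both senders offer full information. -/

import Mathlib

open MeasureTheory

noncomputable section

/-- A Bayes-plausible distribution of posterior beliefs: a Borel probability measure on `[0,1]`
whose mean is the prior `μ`. -/
abbrev Offer (μ : ℝ) : Type :=
  {p : ProbabilityMeasure unitInterval // ∫ x, (x : ℝ) ∂(p : Measure unitInterval) = μ}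

/-- The measure on `[0,1]` underlying an offer. -/
abbrev Offer.law {μ : ℝ} (p : Offer μ) : Measure unitInterval := (p.1 : Measure unitInterval)

/-- `q` is a garbling (mean-preserving contraction) of `p`: both have mean `μ`, and `q`
second-order stochastically dominates `p`, that is, every nondecreasing concave utility
function has at least as high an expectation under `q` as under `p`. -/
def IsGarbling {μ : ℝ} (q p : Offer μ) : Prop :=
  ∀ u : ℝ → ℝ, Monotone u → ConcaveOn ℝ Set.univ u →
    ∫ x, u (x : ℝ) ∂p.law ≤ ∫ x, u (x : ℝ) ∂q.law

/-- Full information: the posterior is `1` with probability `μ` and `0` with probability `1 - μ`. -/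
def IsFullInformation {μ : ℝ} (p : Offer μ) : Prop :=
  p.law = ENNReal.ofReal (1 - μ) • Measure.dirac 0 + ENNReal.ofReal μ • Measure.dirac 1

/-- The two senders are `0` and `1`; `other i` is the competitor of sender `i`. -/
def other (i : Fin 2) : Fin 2 := 1 - i

/-- Attention cost of a single posterior `x`; the cost of a distribution is its expectation. -/
def attentionCost (k μ : ℝ) (x : unitInterval) : ℝ := k * ((x : ℝ) - μ) ^ 2

/-- The receiver's expected payoff when her belief about the first visited sender is `x`, she
visits the other sender and draws from `q` there: she then selects the sender with the higher
posterior, so that a draw `y` yields `max x y` (gross of the cost already paid for `x`). -/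
def secondVisitPayoff (k μ : ℝ) (x : unitInterval) (q : Offer μ) : ℝ :=
  ∫ y, (max (x : ℝ) (y : ℝ) - attentionCost k μ y) ∂q.law

/-- Probability with which the first of two senders is selected when the posteriors about the
first and the second are `x` and `y` and ties are broken for the first with probability `t`. -/
def pickFirst (t : unitInterval) (x y : ℝ) : ℝ :=
  if y < x then 1 else if x < y then 0 else (t : ℝ)

/-- A strategy of the receiver. In every field the argument `i : Fin 2` is the sender who was
visited first and `x` is the belief drawn there. -/
structure ReceiverStrategy (k μ : ℝ) where
  /-- `none`: visit nobody; `some r`: visit sender `0` first with probability `r` and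
  sender `1` first with probability `1 - r`. -/
  start : Option unitInterval
  /-- Probability of selecting sender `0` if nobody is visited. -/
  blindPick : unitInterval
  /-- Garbling chosen at the first visited sender, for each offer observed there. -/
  garbleFirst : Fin 2 → Offer μ → Offer μ
  garbleFirst_feasible : ∀ i p, IsGarbling (garbleFirst i p) p
  /-- Beliefs `x` after which the second sender is visited. -/
  visitSecond : Fin 2 → Set unitInterval
  /-- Garbling chosen at the second visited sender, for each belief and each offer. -/
  garbleSecond : Fin 2 → unitInterval → Offer μ → Offer μ
  garbleSecond_feasible : ∀ i x p, IsGarbling (garbleSecond i x p) p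
  /-- Probability of selecting the first visited sender if both have been visited and the
  posteriors are equal. -/
  tieVisited : Fin 2 → unitInterval → Offer μ → unitInterval
  /-- Probability of selecting the first visited sender if the second has not been visited and
  the belief about the first equals the prior. -/
  tieUnvisited : Fin 2 → unitInterval
  /-- Measurability in the first-stage belief, so that expected payoffs make sense. -/
  measurable_visitSecond : ∀ i, MeasurableSet (visitSecond i)
  measurable_receiver : ∀ i p, Measurable fun x => secondVisitPayoff k μ x (garbleSecond i x p)
  measurable_sender : ∀ i p, Measurable fun x : unitInterval =>
    ∫ y, pickFirst (tieVisited i x p) (x : ℝ) (y : ℝ) ∂(garbleSecond i x p).law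

namespace ReceiverStrategy

variable {k μ : ℝ} (σ : ReceiverStrategy k μ)

open Classical in
/-- The receiver's continuation payoff after sender `i` was visited first and `x` was drawn, when
the other sender's offer is `p`. An unvisited sender is believed to have quality `μ`. -/
def continuationPayoff (i : Fin 2) (x : unitInterval) (p : Offer μ) : ℝ :=
  if x ∈ σ.visitSecond i then secondVisitPayoff k μ x (σ.garbleSecond i x p) else max (x : ℝ) μ

/-- The receiver's payoff from drawing her first belief, about sender `i`, from `q`, when the
other sender's offer is `p`. -/
def firstVisitPayoff (i : Fin 2) (q p : Offer μ) : ℝ :=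
  ∫ x, (σ.continuationPayoff i x p - attentionCost k μ x) ∂q.law

/-- The receiver's expected payoff under the offers `p` if she starts with `s` and then follows
`σ`. -/
def payoffFrom (p : Fin 2 → Offer μ) : Option unitInterval → ℝ
  | none => μ
  | some r =>
      (r : ℝ) * σ.firstVisitPayoff 0 (σ.garbleFirst 0 (p 0)) (p 1)
        + (1 - (r : ℝ)) * σ.firstVisitPayoff 1 (σ.garbleFirst 1 (p 1)) (p 0)

/-- The receiver's expected payoff under the offers `p`. -/
def receiverPayoff (p : Fin 2 → Offer μ) : ℝ := σ.payoffFrom p σ.start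

open Classical in
/-- Probability that the first visited sender `i` is selected after the belief `x`, when the
other sender's offer is `p`. -/
def pickFirstAfter (i : Fin 2) (x : unitInterval) (p : Offer μ) : ℝ :=
  if x ∈ σ.visitSecond i then
    ∫ y, pickFirst (σ.tieVisited i x p) (x : ℝ) (y : ℝ) ∂(σ.garbleSecond i x p).law
  else pickFirst (σ.tieUnvisited i) (x : ℝ) μ

/-- Probability that sender `i` is selected, given that he is visited first. -/
def pickedWhenFirst (i : Fin 2) (p : Fin 2 → Offer μ) : ℝ :=
  ∫ x, σ.pickFirstAfter i x (p (other i)) ∂(σ.garbleFirst i (p i)).law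

/-- Probability that sender `0` is selected under the offers `p`. -/
def pickZero (p : Fin 2 → Offer μ) : ℝ :=
  match σ.start with
  | none => (σ.blindPick : ℝ)
  | some r => (r : ℝ) * σ.pickedWhenFirst 0 p + (1 - (r : ℝ)) * (1 - σ.pickedWhenFirst 1 p)

/-- Sender `i`'s expected payoff: the probability that he is selected. -/
def senderPayoff (i : Fin 2) (p : Fin 2 → Offer μ) : ℝ :=
  if i = 0 then σ.pickZero p else 1 - σ.pickZero p

end ReceiverStrategy

/-- `(p, σ)` is a subgame perfect equilibrium: each sender's offer is a best response, and the
receiver acts optimally at each of her decision nodes, on and off the path of play. She does not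
observe an offer before visiting its sender, so that up to that visit she takes it to be the
equilibrium offer. -/
structure IsEquilibrium (k μ : ℝ) (p : Fin 2 → Offer μ) (σ : ReceiverStrategy k μ) : Prop where
  /-- No sender gains from a unilateral deviation. -/
  sender_optimal : ∀ (i : Fin 2) (p' : Offer μ),
    σ.senderPayoff i (Function.update p i p') ≤ σ.senderPayoff i p
  /-- The decision whether to visit anybody, and in which order. -/
  start_optimal : ∀ s : Option unitInterval, σ.payoffFrom p s ≤ σ.payoffFrom p σ.start
  /-- The garbling at the first visited sender, whatever he offers. -/
  garbleFirst_optimal : ∀ (i : Fin 2) (p' q : Offer μ), IsGarbling q p' →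
    σ.firstVisitPayoff i q (p (other i)) ≤
      σ.firstVisitPayoff i (σ.garbleFirst i p') (p (other i))
  /-- The decision whether to visit the second sender. -/
  visitSecond_optimal : ∀ (i : Fin 2) (x : unitInterval),
    max (x : ℝ) μ ≤ σ.continuationPayoff i x (p (other i)) ∧
    secondVisitPayoff k μ x (σ.garbleSecond i x (p (other i))) ≤
      σ.continuationPayoff i x (p (other i))
  /-- The garbling at the second visited sender, whatever he offers. -/
  garbleSecond_optimal : ∀ (i : Fin 2) (x : unitInterval) (p' q : Offer μ), IsGarbling q p' →
    secondVisitPayoff k μ x q ≤ secondVisitPayoff k μ x (σ.garbleSecond i x p')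

/-- `v` is the receiver's first-best payoff: the best she can achieve across all profiles of
sender offers and all strategies of her own. -/
def IsFirstBestPayoff (k μ v : ℝ) : Prop :=
  IsLUB {w : ℝ | ∃ (p : Fin 2 → Offer μ) (σ : ReceiverStrategy k μ), w = σ.receiverPayoff p} v

end

/-! Full information makes every offer a feasible garbling. Let `V x` (`secondVisitValue`) be the
receiver's continuation value after the belief `x` if everything is feasible at the second sender.
The first-best payoff `v` is then the value at `μ` of the concave envelope of `V x - k (x - μ) ^ 2`
on `[0,1]`. A line supports this envelope at `μ`, and every first draw that achieves first best
lives on the contact points of that line (`ae_touches`). With full information on both sides the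
receiver attains `v`, which settles one direction.

For the converse, start from a first-best equilibrium. If `v = V μ`, learning about a single sender
is already optimal. The optimal pair is then symmetric around `μ`
(`LearningPair.symmetric_of_touches_prior`), so a sender about whom she learns is selected with
probability `1/2`. Let both senders offer full information and let the receiver learn only at the
first sender if he does so, and only at the second if he does not. Under every unilateral deviation
both senders win with probability `1/2` (`exists_fullInfo_equilibrium`).

If `V μ < v`, there is a contradiction. For `μ ≤ 1/2` the line has exactly two contact points, `0`
and some `e > μ`, and after `e` it is optimal to learn at the second sender with posteriors `0` and
`b` (`exists_touches_eq_of_le_half`). For `μ ≥ 1/2` the reflection `x ↦ 1 - x` gives contact points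
`c` and `1`. With only two contact points the first draw is unique, so an offer that still permits
it does not change behaviour at a first visit (`IsEquilibrium.deviation_le`). Restricting the offer
can then only matter at a second visit. For `μ ≤ 1/2`, offering `0` and a posterior slightly below
`b` makes the high posterior more likely and wins more often against `e`. For `μ ≥ 1/2`, offering
just `c` and `1` makes learning after `c` worthless, so that the second sender wins there for sure.
Both deviations are profitable (`IsEquilibrium.receiverPayoff_le_of_firstBest`). -/

/-! ### Real-variable analysis: the supporting line and conditions at its contact points -/

/-- `a < x < b` are the two posteriors chosen at the second sender after the belief `x`, and `V x`
is the resulting payoff; the last four fields are the tangency conditions at `a` and `b`. -/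
structure LearningPair (k μ : ℝ) (V : ℝ → ℝ) (x a b : ℝ) : Prop where
  nonneg : 0 ≤ a
  left_lt : a < x
  lt_right : x < b
  le_one : b ≤ 1
  left_lt_prior : a < μ
  prior_lt_right : μ < b
  value : (b - a) * V x = x * (b - μ) + b * (μ - a) - k * (b - μ) * (μ - a) * (b - a)
  left_le : k * (b - a) ^ 2 ≤ b - x
  left_eq : 0 < a → k * (b - a) ^ 2 = b - x
  right_le : k * (b - a) ^ 2 ≤ x - a
  right_eq : b < 1 → k * (b - a) ^ 2 = x - a

/-- The properties of the value `V` of an optimal decision about the second visit, as a function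
of the belief about the first sender, when any offer is available at the second sender. -/
structure IsSecondVisitValue (k μ : ℝ) (V : ℝ → ℝ) : Prop where
  twoPoint_le : ∀ x a b, 0 ≤ x → x ≤ 1 → 0 ≤ a → a < μ → μ < b → b ≤ 1 →
    (b - μ) * (max x a - k * (a - μ) ^ 2) + (μ - a) * (max x b - k * (b - μ) ^ 2) ≤ (b - a) * V x
  max_le : ∀ x, 0 ≤ x → x ≤ 1 → max x μ ≤ V x
  eq_or_pair : ∀ x, 0 ≤ x → x ≤ 1 → V x = max x μ ∨ ∃ a b, LearningPair k μ V x a b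

/-- The line `L + s (x - μ)` lies above `V x - k (x - μ) ^ 2` on `[0,1]`. -/
def IsUpperLine (k μ : ℝ) (V : ℝ → ℝ) (L s : ℝ) : Prop :=
  ∀ x, 0 ≤ x → x ≤ 1 → V x - k * (x - μ) ^ 2 ≤ L + s * (x - μ)

/-- The line `L + s (x - μ)` meets `V x - k (x - μ) ^ 2` at the point `x` of `[0,1]`. -/
def Touches (k μ : ℝ) (V : ℝ → ℝ) (L s x : ℝ) : Prop :=
  0 ≤ x ∧ x ≤ 1 ∧ V x - k * (x - μ) ^ 2 = L + s * (x - μ)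

lemma eq_zero_of_forall_small_quadratic_nonneg {k m ε : ℝ} (hk : 0 < k) (hε : 0 < ε)
    (h : ∀ t, -ε < t → t < ε → 0 ≤ m * t + k * t ^ 2) : m = 0 := by
  by_contra hm
  rcases lt_or_gt_of_ne hm with hm | hm
  · have h0 : 0 < min (ε / 2) (-m / (2 * k)) :=
      lt_min (by linarith) (div_pos (by linarith) (by linarith))
    set t := min (ε / 2) (-m / (2 * k)) with ht
    have h1 : t ≤ ε / 2 := min_le_left _ _
    have h2 : t ≤ -m / (2 * k) := min_le_right _ _
    rw [le_div_iff₀ (by linarith)] at h2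
    have := h t (by linarith) (by linarith)
    nlinarith
  · have h0 : 0 < min (ε / 2) (m / (2 * k)) :=
      lt_min (by linarith) (div_pos (by linarith) (by linarith))
    set t := min (ε / 2) (m / (2 * k)) with ht
    have h1 : t ≤ ε / 2 := min_le_left _ _
    have h2 : t ≤ m / (2 * k) := min_le_right _ _
    rw [le_div_iff₀ (by linarith)] at h2
    have := h (-t) (by linarith) (by linarith)
    nlinarith

section

variable {k μ : ℝ} {V : ℝ → ℝ} {L s : ℝ}

/-- The tangency inequalities give `k (b - μ) (b - a) < b - x` and `k (μ - a) (b - a) < x - a`, so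
the gain from learning exceeds its cost, whichever sender is the default choice. -/
lemma LearningPair.max_lt {x a b : ℝ} (hk : 0 < k) (h : LearningPair k μ V x a b) :
    max x μ < V x := by
  obtain ⟨h1, h2, h3, h4, h5, h6, h7, h8, -, h10, -⟩ := h
  have hN : 0 < b - a := by linarith
  have hku : k * (b - μ) * (b - a) < k * (b - a) ^ 2 := by
    have : 0 < k * (b - a) * (μ - a) := by
      have := sub_pos.2 h5; positivity
    nlinarith
  have hkt : k * (μ - a) * (b - a) < k * (b - a) ^ 2 := by
    have : 0 < k * (b - a) * (b - μ) := by
      have := sub_pos.2 h6; positivity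
    nlinarith
  refine _root_.max_lt ?_ ?_
  · refine lt_of_mul_lt_mul_left (a := b - a) ?_ hN.le
    have := mul_pos (sub_pos.2 h5) (sub_pos.2 (hku.trans_le h8))
    nlinarith
  · refine lt_of_mul_lt_mul_left (a := b - a) ?_ hN.le
    have := mul_pos (sub_pos.2 h6) (sub_pos.2 (hkt.trans_le h10))
    nlinarith

/-- An envelope argument: with `a` and `b` held fixed, the payoff is affine in the first belief,
with slope `(b - μ) / (b - a)`, lies below `V` near `e` and equals it at `e`. Hence the line is
tangent to that payoff minus the first attention cost. -/
lemma LearningPair.slope_eq {e a b : ℝ} (hk : 0 < k) (hV : IsSecondVisitValue k μ V)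
    (hL : IsUpperLine k μ V L s) (h : LearningPair k μ V e a b) (ht : Touches k μ V L s e) :
    s * (b - a) = (b - μ) - 2 * k * (e - μ) * (b - a) := by
  obtain ⟨h1, h2, h3, h4, h5, h6, h7, -, -, -, -⟩ := h
  have hN : 0 < b - a := by linarith
  have hε : 0 < min (e - a) (b - e) := lt_min (by linarith) (by linarith)
  have hz : (s * (b - a) - ((b - μ) - 2 * k * (e - μ) * (b - a))) = 0 := by
    refine eq_zero_of_forall_small_quadratic_nonneg (k := k * (b - a)) (by positivity) hε ?_
    intro t ht1 ht2
    have hl := min_le_left (e - a) (b - e)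
    have hr := min_le_right (e - a) (b - e)
    have hx := hL (e + t) (by linarith) (by linarith)
    have hx' := hV.twoPoint_le (e + t) a b (by linarith) (by linarith) h1 h5 h6 h4
    rw [max_eq_left (by linarith), max_eq_right (by linarith)] at hx'
    have hx2 := mul_le_mul_of_nonneg_left hx hN.le
    have hte := ht.2.2
    have hte2 : (b - a) * V e = (b - a) * (L + s * (e - μ) + k * (e - μ) ^ 2) := by
      rw [← hte]; ring
    nlinarith
  linarith

/-- The height of the line at `0`, with `s` and `V e` eliminated. It serves to compare a contact
point with the belief `0` or with another contact point. -/
lemma LearningPair.intercept_eq {e a b : ℝ} (hk : 0 < k) (hV : IsSecondVisitValue k μ V)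
    (hL : IsUpperLine k μ V L s) (h : LearningPair k μ V e a b) (ht : Touches k μ V L s e) :
    (b - a) * (L - s * μ) = (μ + k * e ^ 2 - k * μ ^ 2 - k * (b - μ) * (μ - a)) * (b - a)
      - a * (b - μ) := by
  have hs := h.slope_eq hk hV hL ht
  have hv := h.value
  have ht' := ht.2.2
  linear_combination (-e) * hs + hv - (b - a) * ht'

/-- Below the prior `V` is at least `μ`, with equality at `c`, so the line is tangent to `μ - k (x -
μ) ^ 2` there. -/
lemma slope_eq_of_touches_unvisited {c : ℝ} (hk : 0 < k) (hμ1 : μ < 1)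
    (hV : IsSecondVisitValue k μ V) (hL : IsUpperLine k μ V L s) (hc0 : 0 < c) (hcμ : c < μ)
    (hc : V c = max c μ) (ht : Touches k μ V L s c) : s = 2 * k * (μ - c) := by
  rw [max_eq_right hcμ.le] at hc
  have : s - 2 * k * (μ - c) = 0 := by
    refine eq_zero_of_forall_small_quadratic_nonneg hk (lt_min hc0 (sub_pos.2 hcμ)) ?_
    intro t ht1 ht2
    have hl := min_le_left c (μ - c)
    have hr := min_le_right c (μ - c)
    have hx := hL (c + t) (by linarith) (by linarith)
    have hx' := (le_max_right _ _).trans (hV.max_le (c + t) (by linarith) (by linarith))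
    have := ht.2.2
    rw [hc] at this
    nlinarith
  linarith

/-- Second-order condition at a touching point with lower posterior `0`. -/
lemma LearningPair.second_order {e b : ℝ} (hk : 0 < k) (hμ0 : 0 < μ)
    (hV : IsSecondVisitValue k μ V)
    (hL : IsUpperLine k μ V L s) (h : LearningPair k μ V e 0 b) (hb : b < 1)
    (ht : Touches k μ V L s e) : μ ≤ 4 * k ^ 2 * b ^ 3 := by
  have hs := h.slope_eq hk hV hL ht
  have hi := h.intercept_eq hk hV hL ht
  have he := h.right_eq hb
  obtain ⟨h1, h2, h3, h4, h5, h6, h7, -, -, -, -⟩ := h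
  have he' : e = k * b ^ 2 := by linarith
  have hb0 : 0 < b := by linarith
  -- The line is tested at the belief `k z ^ 2`, where the pair `0`, `z` satisfies the first-order
  -- condition for an interior upper posterior. Any `z` strictly between `μ` and `b` would do.
  obtain ⟨z, hz⟩ : ∃ z, z = (μ + b) / 2 := ⟨_, rfl⟩
  have hz0 : 0 < z := by linarith
  have hzb : z < b := by linarith
  have hx0 : 0 ≤ k * z ^ 2 := by positivity
  have hx1 : k * z ^ 2 ≤ 1 := by
    have : k * z ^ 2 ≤ k * b ^ 2 := by gcongr
    linarith
  have hA := hL _ hx0 hx1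
  have hB := hV.twoPoint_le (k * z ^ 2) 0 z hx0 hx1 le_rfl h5 (by linarith) (by linarith)
  rw [max_eq_left hx0] at hB
  have hC := mul_le_mul_of_nonneg_left (le_max_right (k * z ^ 2) z) hμ0.le
  have hD := mul_le_mul_of_nonneg_left hA hz0.le
  have hi' : L - s * μ = μ + k * e ^ 2 - k * μ * b := by
    have : b * (L - s * μ) = b * (μ + k * e ^ 2 - k * μ * b) := by linear_combination hi
    exact mul_left_cancel₀ hb0.ne' this
  have key : 0 ≤ b * (z * (L - s * μ + s * (k * z ^ 2) + k * (k * z ^ 2 - μ) ^ 2)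
      - ((z - μ) * (k * z ^ 2 - k * μ ^ 2) + μ * (z - k * (z - μ) ^ 2))) := by
    refine mul_nonneg hb0.le ?_
    nlinarith
  -- The gap has a double zero at `z = b`; the sign of the remaining factor is the second-order
  -- condition.
  have hid : b * (z * (L - s * μ + s * (k * z ^ 2) + k * (k * z ^ 2 - μ) ^ 2)
      - ((z - μ) * (k * z ^ 2 - k * μ ^ 2) + μ * (z - k * (z - μ) ^ 2)))
      = z * k * (z - b) ^ 2 * (k ^ 2 * b * (z + b) ^ 2 - μ) := by
    rw [hi']
    subst he'
    linear_combination (z * k * z ^ 2) * hs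
  rw [hid] at key
  have hzb2 : 0 < (z - b) ^ 2 := by
    have : z - b ≠ 0 := by linarith
    positivity
  have h3 : 0 ≤ k ^ 2 * b * (z + b) ^ 2 - μ := nonneg_of_mul_nonneg_right key (by positivity)
  have h4 : (z + b) ^ 2 ≤ (2 * b) ^ 2 := by gcongr; linarith
  have h5 : k ^ 2 * b * (z + b) ^ 2 ≤ k ^ 2 * b * (2 * b) ^ 2 := by gcongr
  nlinarith

/-! ### The symmetry `x ↦ 1 - x` -/

lemma LearningPair.reflect {x a b : ℝ} (h : LearningPair k μ V x a b) :
    LearningPair k (1 - μ) (fun x => V (1 - x) + x - μ) (1 - x) (1 - b) (1 - a) := by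
  obtain ⟨h1, h2, h3, h4, h5, h6, h7, h8, h9, h10, h11⟩ := h
  refine ⟨by linarith, by linarith, by linarith, by linarith, by linarith, by linarith, ?_, ?_,
    ?_, ?_, ?_⟩
  · simp only [sub_sub_cancel]
    linear_combination h7
  · linarith
  · intro h; linarith [h11 (by linarith)]
  · linarith
  · intro h; linarith [h9 (by linarith)]

lemma max_reflect (x y : ℝ) : max (1 - x) (1 - y) = 1 - x - y + max x y := by
  rcases le_total x y with h | h
  · rw [max_eq_right h, max_eq_left (by linarith)]; ring
  · rw [max_eq_left h, max_eq_right (by linarith)]; ring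

/-- By `max_reflect` the selected posterior changes by an affine function of both beliefs, and the
second belief has mean `μ`. This accounts for the correction `x - μ` in the reflected value. -/
lemma IsSecondVisitValue.reflect (hV : IsSecondVisitValue k μ V) :
    IsSecondVisitValue k (1 - μ) (fun x => V (1 - x) + x - μ) := by
  refine ⟨?_, ?_, ?_⟩
  · intro x a b hx0 hx1 ha haμ hμb hb
    have := hV.twoPoint_le (1 - x) (1 - b) (1 - a) (by linarith) (by linarith) (by linarith)
      (by linarith) (by linarith) (by linarith)
    rw [max_reflect, max_reflect] at this
    linarith
  · intro x hx0 hx1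
    have := hV.max_le (1 - x) (by linarith) (by linarith)
    have h2 := max_reflect x (1 - μ)
    rw [sub_sub_cancel] at h2
    linarith
  · intro x hx0 hx1
    have h2 := max_reflect x (1 - μ)
    rw [sub_sub_cancel] at h2
    rcases hV.eq_or_pair (1 - x) (by linarith) (by linarith) with h | ⟨a, b, h⟩
    · left; linarith
    · right
      have := h.reflect
      rw [sub_sub_cancel] at this
      exact ⟨_, _, this⟩

lemma IsUpperLine.reflect (hL : IsUpperLine k μ V L s) :
    IsUpperLine k (1 - μ) (fun x => V (1 - x) + x - μ) (L + 1 - 2 * μ) (1 - s) := by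
  intro x hx0 hx1
  have := hL (1 - x) (by linarith) (by linarith)
  linarith

lemma Touches.reflect {x : ℝ} (h : Touches k μ V L s x) :
    Touches k (1 - μ) (fun x => V (1 - x) + x - μ) (L + 1 - 2 * μ) (1 - s) (1 - x) := by
  obtain ⟨h0, h1, h2⟩ := h
  refine ⟨by linarith, by linarith, ?_⟩
  simp only [sub_sub_cancel]
  linarith

/-- Second-order condition at a touching point with upper posterior `1`. -/
lemma LearningPair.second_order_one {e a : ℝ} (hk : 0 < k) (hμ1 : μ < 1)
    (hV : IsSecondVisitValue k μ V) (hL : IsUpperLine k μ V L s) (h : LearningPair k μ V e a 1)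
    (ha : 0 < a) (ht : Touches k μ V L s e) : 1 - μ ≤ 4 * k ^ 2 * (1 - a) ^ 3 := by
  have h' := h.reflect
  rw [sub_self] at h'
  exact h'.second_order hk (by linarith) hV.reflect hL.reflect (by linarith) ht.reflect

/-! ### Comparison with the problem in which posteriors may leave `[0,1]` -/

/-- The right-hand side is the supporting line of the problem without the bounds `0 ≤ a` and `b ≤
1`. -/
lemma IsSecondVisitValue.le_unconstrained (hk : 0 < k) (hV : IsSecondVisitValue k μ V) {x : ℝ}
    (hx0 : 0 ≤ x) (hx1 : x ≤ 1) :
    V x - k * (x - μ) ^ 2 ≤ (x + μ) / 2 + 1 / (16 * k) := by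
  have hk2 : 0 < 16 * k := by linarith
  have hkey : 16 * k * (1 / (16 * k)) = 1 := by field_simp
  refine le_of_mul_le_mul_left ?_ hk2
  rw [mul_add, hkey]
  rcases hV.eq_or_pair x hx0 hx1 with h | ⟨a, b, h⟩
  · rw [h]
    rcases le_total x μ with hx | hx
    · rw [max_eq_right hx]
      nlinarith [sq_nonneg (4 * k * (x - μ) + 1)]
    · rw [max_eq_left hx]
      nlinarith [sq_nonneg (4 * k * (x - μ) - 1)]
  · have hN : 0 < b - a := by linarith [h.left_lt, h.lt_right]
    have hu := sub_pos.2 h.left_lt_prior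
    have hw := sub_pos.2 h.prior_lt_right
    have hv := h.value
    -- `G` is the probability of the lower posterior. In terms of `G` and the width `N` the deficit
    -- is a sum of squares that vanishes for `N = 1 / (2 k)` and `x - μ = (G - 1/2) / (2 k)`.
    set G := (b - μ) / (b - a) with hG
    have hGb : b - μ = G * (b - a) := by rw [hG]; field_simp
    have hGa : μ - a = (1 - G) * (b - a) := by linarith
    have hG0 : 0 ≤ G := by positivity
    have hG1 : 0 ≤ 1 - G := by
      by_contra hc
      nlinarith
    have hVx : V x = x * G + b * (1 - G) - k * (b - a) ^ 2 * G * (1 - G) := by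
      refine mul_left_cancel₀ hN.ne' ?_
      rw [hv, hGb, hGa]; ring
    have hb : b = μ + G * (b - a) := by linarith
    set N := b - a
    rw [hVx, hb]
    nlinarith [mul_nonneg (mul_nonneg hG0 hG1) (sq_nonneg (2 * k * N - 1)),
      sq_nonneg (2 * k * (x - μ) - (G - 1 / 2))]


/-- If stopping after each of two touching beliefs on either side of the prior is optimal, then
visiting a single sender is optimal. -/
lemma le_of_touches_unvisited {c e : ℝ}
    (hV : IsSecondVisitValue k μ V) (hcμ : c < μ) (hμe : μ < e) (hc : Touches k μ V L s c)
    (he : Touches k μ V L s e) (hVc : V c = max c μ) (hVe : V e = max e μ) (hμ0 : 0 ≤ μ)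
    (hμ1 : μ ≤ 1) : L ≤ V μ := by
  rw [max_eq_right hcμ.le] at hVc
  rw [max_eq_left hμe.le] at hVe
  have h := hV.twoPoint_le μ c e hμ0 hμ1 hc.1 hcμ hμe he.2.1
  rw [max_eq_left hcμ.le, max_eq_right hμe.le] at h
  have h1 := hc.2.2
  have h2 := he.2.2
  rw [hVc] at h1
  rw [hVe] at h2
  rw [h1, h2] at h
  refine le_of_mul_le_mul_left (a := e - c) ?_ (by linarith)
  linarith

/-- If the optimal pair at a touching belief has the unconstrained width `1 / (2 k)`, the boundary
of `[0,1]` is irrelevant and the touching line is the unconstrained one. -/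
lemma LearningPair.line_eq_of_width {e a b : ℝ} (hk : 0 < k) (hV : IsSecondVisitValue k μ V)
    (hL : IsUpperLine k μ V L s) (h : LearningPair k μ V e a b) (ht : Touches k μ V L s e)
    (hw : 2 * k * (b - a) = 1) :
    s = 1 / 2 ∧ L = μ + 1 / (16 * k) ∧ e = a + 1 / (4 * k) := by
  have hs := h.slope_eq hk hV hL ht
  have hi := h.intercept_eq hk hV hL ht
  have hab : b = a + 1 / (2 * k) := by
    field_simp
    linarith
  have h8 := h.left_le
  have h10 := h.right_le
  have he : e = a + 1 / (4 * k) := by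
    have h1 : k * (b - a) ^ 2 = (b - a) / 2 := by linear_combination (b - a) / 2 * hw
    have h2 : 1 / (4 * k) = (b - a) / 2 := by rw [hab]; field_simp; norm_num
    linarith
  have hs' : s = 1 / 2 := by
    subst hab he
    field_simp at hs
    linarith
  refine ⟨hs', ?_, he⟩
  subst hab he hs'
  field_simp at hi ⊢
  nlinarith

lemma LearningPair.two_mul_width_le {e a b : ℝ} (h : LearningPair k μ V e a b) :
    2 * k * (b - a) ≤ 1 := by
  have h8 := h.left_le
  have h10 := h.right_le
  have hN : 0 < b - a := by linarith [h.left_lt, h.lt_right]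
  by_contra hc
  nlinarith

/-- If learning at a single sender is not optimal, the unconstrained optimal pair around the prior
does not fit into `[0,1]`. -/
lemma four_mul_lt_one (hk : 0 < k) (hμ : μ ≤ 1 / 2) (hμ0 : 0 < μ) (hV : IsSecondVisitValue k μ V)
    {c e : ℝ} (hVL : V μ < L) (hcμ : c < μ) (hμe : μ < e) (hc : Touches k μ V L s c)
    (he : Touches k μ V L s e) : 4 * k * μ < 1 := by
  by_contra! hd
  -- The supporting line is below the unconstrained one at contact points on both sides of `μ`,
  -- hence also at `μ`.
  have hL : L ≤ μ + 1 / (16 * k) := by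
    have h1 := hV.le_unconstrained hk hc.1 hc.2.1
    have h2 := hV.le_unconstrained hk he.1 he.2.1
    rw [hc.2.2] at h1
    rw [he.2.2] at h2
    refine le_of_mul_le_mul_left (a := e - c) ?_ (by linarith)
    nlinarith
  have hd' : 1 / (4 * k) ≤ μ := by
    rw [div_le_iff₀ (by linarith)]; linarith
  have hd0 : 0 < 1 / (4 * k) := by positivity
  have h := hV.twoPoint_le μ (μ - 1 / (4 * k)) (μ + 1 / (4 * k)) hμ0.le (by linarith)
    (by linarith) (by linarith) (by linarith) (by linarith)
  rw [max_eq_left (by linarith), max_eq_right (by linarith)] at h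
  have : μ + 1 / (16 * k) ≤ V μ := by
    refine le_of_mul_le_mul_left (a := 2 * (1 / (4 * k))) ?_ (by linarith)
    have e1 : k * (1 / (4 * k)) ^ 2 = 1 / (16 * k) := by field_simp; norm_num
    have e2 : 1 / (16 * k) = (1 / (4 * k)) / 4 := by field_simp; norm_num
    rw [e2] at e1 ⊢
    set d := 1 / (4 * k)
    nlinarith
  linarith

/-! ### Excluding contact points strictly between `0` and the prior -/

/-- The contact conditions in units of `b`, with `β = k b = c / b` and `ρ = μ / b`. The hypotheses
confine `β` to the interval from `1/4` to `1/2`; the two estimates overlap around `2/5`. -/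
lemma not_le_sq_add_sq {β ρ : ℝ} (hβ0 : 0 < β) (hρβ : β < ρ) (hρ2 : ρ ≤ 4 * β ^ 2)
    (h4 : 4 * β * ρ < 1) : ¬ ρ ≤ β ^ 2 + ρ ^ 2 := by
  intro hS
  have hβ1 : β < 1 / 2 := by nlinarith
  have hβ2 : 1 / 4 < β := by nlinarith
  by_cases hβ3 : β ≤ 2 / 5
  · have h1 : ρ * (1 - β - 4 * β ^ 2) ≤ β ^ 2 * (1 - 4 * β) := by
      nlinarith [mul_nonneg (sub_nonneg.2 hρβ.le) (sub_nonneg.2 hρ2)]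
    have h2 : β ^ 2 * (1 - 4 * β) < 0 := mul_neg_of_pos_of_neg (by positivity) (by linarith)
    rcases le_total 0 (1 - β - 4 * β ^ 2) with h3 | h3
    · have := mul_nonneg (hβ0.trans hρβ).le h3
      linarith
    · have h5 := mul_le_mul_of_nonpos_right hρ2 h3
      have h6 : β ^ 2 * (3 - 16 * β ^ 2) ≤ 0 := by nlinarith
      have h7 : 0 < β ^ 2 * (3 - 16 * β ^ 2) := mul_pos (by positivity) (by nlinarith)
      linarith
  · have h5 : 0 < (ρ - β) * (1 - 4 * β * ρ) := mul_pos (by linarith) (by linarith)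
    have h6 : 4 * β * ρ ≤ 4 * β * (β ^ 2 + ρ ^ 2) := by gcongr
    have h7 : 0 < (1 - 2 * β) * (ρ * (1 - 2 * β) - β * (1 + 2 * β)) := by nlinarith
    have h8 : 0 < ρ * (1 - 2 * β) - β * (1 + 2 * β) := pos_of_mul_pos_right h7 (by linarith)
    have h9 : 4 * β * ρ * (1 - 2 * β) ≤ 1 * (1 - 2 * β) :=
      mul_le_mul_of_nonneg_right h4.le (by linarith)
    have h10 : 0 < 4 * β * (ρ * (1 - 2 * β) - β * (1 + 2 * β)) := by positivity
    have h11 : 0 ≤ 8 * β ^ 3 + 4 * β ^ 2 + 2 * β - 1 := by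
      have : (2 / 5) ^ 3 ≤ β ^ 3 := by gcongr; linarith
      nlinarith
    nlinarith

/-- If `a = 0`, the line would pass below the value of the belief `0`: this is immediate for `b = 1`
and otherwise follows from the second-order condition. If `a > 0`, the tangency conditions and `c <
μ ≤ 1/2` force `b < 1`, hence the unconstrained width, and then `c = a + 1 / (4 k) > μ`. -/
lemma no_interior_pair_below {c a b : ℝ} (hk : 0 < k) (hμ0 : 0 < μ) (hμ : μ ≤ 1 / 2)
    (h4 : 4 * k * μ < 1) (hV : IsSecondVisitValue k μ V) (hL : IsUpperLine k μ V L s)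
    (h : LearningPair k μ V c a b) (hcμ : c < μ) (ht : Touches k μ V L s c) : False := by
  have hab : 0 < b - a := by linarith [h.left_lt, h.lt_right]
  rcases h.nonneg.eq_or_lt with ha | ha
  · subst ha
    have hi := h.intercept_eq hk hV hL ht
    have h0 := hL 0 le_rfl zero_le_one
    have h0' := (le_max_right _ _).trans (hV.max_le 0 le_rfl zero_le_one)
    have hb := h.prior_lt_right
    have hb0 : 0 < b := by linarith
    have hi' : L - s * μ = μ + k * c ^ 2 - k * μ * b := by
      have : b * (L - s * μ) = b * (μ + k * c ^ 2 - k * μ * b) := by linear_combination hi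
      exact mul_left_cancel₀ hb0.ne' this
    have hS : μ * b ≤ c ^ 2 + μ ^ 2 := by
      refine le_of_mul_le_mul_left (a := k) ?_ hk
      nlinarith
    have hc0 : 0 < c := h.left_lt
    rcases h.le_one.eq_or_lt with hb1 | hb1
    · subst hb1
      nlinarith
    · have hc := h.right_eq hb1
      have h2 := h.second_order hk hμ0 hV hL hb1 ht
      obtain ⟨β, hβ⟩ : ∃ β, β = k * b := ⟨_, rfl⟩
      obtain ⟨ρ, hρ⟩ : ∃ ρ, μ = ρ * b := ⟨μ / b, by field_simp⟩
      have hβ0 : 0 < β := by rw [hβ]; positivity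
      have hcβ : c = β * b := by rw [hβ]; linarith
      have hρβ : β < ρ := by
        rw [hcβ, hρ] at hcμ
        exact lt_of_mul_lt_mul_right hcμ hb0.le
      have hρ2 : ρ ≤ 4 * β ^ 2 := by
        refine le_of_mul_le_mul_right (a := b) ?_ hb0
        rw [← hρ, hβ]
        linarith
      have h4' : 4 * β * ρ < 1 := by
        rw [hβ]
        rw [hρ] at h4
        linarith
      have hS' : ρ ≤ β ^ 2 + ρ ^ 2 := by
        refine le_of_mul_le_mul_right (a := b ^ 2) ?_ (by positivity)
        rw [hcβ, hρ] at hS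
        linarith
      exact not_le_sq_add_sq hβ0 hρβ hρ2 h4' hS'
  · have hle := h.left_eq ha
    have hr := h.right_le
    have hb1 : b < 1 := by linarith
    have hr' := h.right_eq hb1
    have hw : 2 * k * (b - a) = 1 := by
      refine mul_right_cancel₀ hab.ne' ?_
      linarith
    obtain ⟨-, -, he⟩ := h.line_eq_of_width hk hV hL ht hw
    have : μ < 1 / (4 * k) := by
      rw [lt_div_iff₀ (by linarith)]; linarith
    linarith


/-- With `A = 1 - a`, `τ = 2 k A` and `m = 1 - μ`, this quadratic in `m` would have to vanish if the
line touched at `0` and at a belief with posteriors `a > 0` and `1`; see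
`left_eq_zero_of_touches_zero`. The bound `m ≤ A τ ^ 2` is the second-order condition there. -/
lemma quadratic_pos_of_le {A τ m : ℝ} (hA : 0 < A) (hτ0 : 0 < τ) (hτ1 : τ < 1) (hA1 : A ≤ 1)
    (hm : m ≤ A * τ ^ 2) :
    0 < τ * m ^ 2 + m * (2 * A - 2 - τ * A) + τ * (1 - A * τ / 2) ^ 2 := by
  -- In the first case the quadratic is nonincreasing up to `m = A τ ^ 2`, so its value at that
  -- endpoint decides; in the second its discriminant is negative.
  by_cases hc : 2 * τ * (A * τ ^ 2) ≤ 2 - 2 * A + τ * A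
  · have h1 : 0 ≤ (A * τ ^ 2 - m) * ((2 - 2 * A + τ * A) - τ * (m + A * τ ^ 2)) := by
      refine mul_nonneg (by linarith) ?_
      nlinarith
    have hP : 0 < τ ^ 4 + 2 * τ - 3 / 4 * τ ^ 2 := by nlinarith [pow_pos hτ0 4]
    have h2 : 0 < (τ ^ 4 + 2 * τ - 3 / 4 * τ ^ 2) *
        (1 - 3 * A * τ + A ^ 2 * (τ ^ 4 + 2 * τ - 3 / 4 * τ ^ 2)) := by
      have h3 : 0 < τ * (τ - 1) ^ 2 * (τ + 2) := by
        have : 0 < (τ - 1) ^ 2 := by nlinarith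
        positivity
      nlinarith [sq_nonneg ((τ ^ 4 + 2 * τ - 3 / 4 * τ ^ 2) * A - 3 / 2 * τ)]
    have h4 := mul_pos hτ0 (pos_of_mul_pos_right h2 hP.le)
    linarith
  · push Not at hc
    have hB : 0 ≤ 2 - 2 * A + τ * A := by nlinarith
    have h1 : 2 < A * (2 + τ) := by
      have h2 : τ ^ 3 ≤ τ := by
        have : τ * (τ * τ) ≤ τ * (1 * 1) := by gcongr
        linarith
      nlinarith
    have h2 : 2 - 2 * A + τ * A < τ * (2 - A * τ) := by
      nlinarith [mul_pos (sub_pos.2 hτ1) (sub_pos.2 h1)]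
    have h3 : (2 - 2 * A + τ * A) ^ 2 < (τ * (2 - A * τ)) ^ 2 := by gcongr
    refine pos_of_mul_pos_right (a := 4 * τ) ?_ (by linarith)
    nlinarith [sq_nonneg (2 * τ * m - (2 - 2 * A + τ * A))]

lemma LearningPair.width_eq_of_interior {e a b : ℝ} (h : LearningPair k μ V e a b) (ha : 0 < a)
    (hb : b < 1) : 2 * k * (b - a) = 1 := by
  have hab : 0 < b - a := by linarith [h.left_lt, h.lt_right]
  have h1 := h.left_eq ha
  have h2 := h.right_eq hb
  refine mul_right_cancel₀ hab.ne' ?_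
  linarith

/-- Equating slope and height of the line at `c` and at `e` gives `h1` and `h2`. The unconstrained
width would make `c` negative, `a = 0` would give `e + c ≤ μ`, and `b = 1` with `a > 0` contradicts
the second-order condition at `e`. -/
lemma no_unvisited_touch_below {c e a b : ℝ} (hk : 0 < k) (hμ1 : μ < 1)
    (h4 : 4 * k * μ < 1) (hV : IsSecondVisitValue k μ V) (hL : IsUpperLine k μ V L s)
    (hc0 : 0 < c) (hcμ : c < μ) (hc : V c = max c μ) (htc : Touches k μ V L s c)
    (h : LearningPair k μ V e a b) (hμe : μ < e) (ht : Touches k μ V L s e) : False := by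
  have hs := slope_eq_of_touches_unvisited hk hμ1 hV hL hc0 hcμ hc htc
  rw [max_eq_right hcμ.le] at hc
  have hsl := h.slope_eq hk hV hL ht
  have hi := h.intercept_eq hk hV hL ht
  have hL' : L = μ + k * (μ - c) ^ 2 := by
    have := htc.2.2
    rw [hc, hs] at this
    linarith
  have hw := h.two_mul_width_le
  have hab : 0 < b - a := by linarith [h.left_lt, h.lt_right]
  have h1 : b - μ = 2 * k * (e - c) * (b - a) := by
    rw [hs] at hsl; linarith
  have h2 : e + c = 2 * a + 2 * k * (μ - a) * (b - a) := by
    refine mul_left_cancel₀ (a := k * (b - a) * (e - c)) ?_ ?_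
    · have : 0 < e - c := by linarith
      positivity
    · rw [hL', hs] at hi
      linear_combination -hi + (a + k * (μ - a) * (b - a)) * h1
  have hwne : 2 * k * (b - a) ≠ 1 := by
    intro hw1
    obtain ⟨-, -, he⟩ := h.line_eq_of_width hk hV hL ht hw1
    have h3 : e + c = a + μ := by linear_combination h2 + (μ - a) * hw1
    have : μ < 1 / (4 * k) := by
      rw [lt_div_iff₀ (by linarith)]; linarith
    linarith
  rcases h.nonneg.eq_or_lt with ha | ha
  · subst ha
    nlinarith
  · rcases h.le_one.eq_or_lt with hb1 | hb1
    · subst hb1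
      have h5 := h.second_order_one hk hμ1 hV hL ha ht
      have h6 := h.left_eq ha
      obtain ⟨A, hA⟩ : ∃ A, A = 1 - a := ⟨_, rfl⟩
      obtain ⟨m, hm⟩ : ∃ m, m = 1 - μ := ⟨_, rfl⟩
      rw [← hA] at h5 h6 hwne hw h1 h2 hab
      rw [← hm] at h5 h1
      have hm0 : 0 < m := by linarith
      have hτ : 2 * k * A < 1 := lt_of_le_of_ne hw hwne
      have he : e = 1 - k * A ^ 2 := by linarith
      have hc' : e - c = 2 * A - 4 * k * A ^ 2 + 2 * k * A * m := by
        have : a = 1 - A := by linarith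
        have h7 : μ - a = A - m := by linarith
        rw [h7, this] at h2
        linarith
      rw [hc'] at h1
      have h8 : m * (1 + 2 * k * A) = 4 * k * A ^ 2 := by
        refine mul_left_cancel₀ (a := 1 - 2 * k * A) (by linarith) ?_
        linear_combination h1
      have h9 : 2 * m ≤ (2 * k * A) * (1 + 2 * k * A) * m := by
        have h10 : (2 * k * A) * (1 + 2 * k * A) * m = 2 * (4 * k ^ 2 * A ^ 3) := by
          linear_combination (2 * k * A) * h8
        linarith
      have h10 : (2 : ℝ) ≤ (2 * k * A) * (1 + 2 * k * A) := le_of_mul_le_mul_right h9 hm0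
      have h11 : 0 < (1 - 2 * k * A) * (2 + 2 * k * A) :=
        mul_pos (by linarith) (by positivity)
      linarith
    · exact hwne (h.width_eq_of_interior ha hb1)

/-! ### Uniqueness of the second contact point when the line touches at `0` -/

lemma value_zero (hμ0 : 0 < μ) (hV : IsSecondVisitValue k μ V) : V 0 = μ := by
  rcases hV.eq_or_pair 0 le_rfl zero_le_one with h | ⟨a, b, h⟩
  · rw [h, max_eq_right hμ0.le]
  · linarith [h.nonneg, h.left_lt]

lemma intercept_of_touches_zero (hμ0 : 0 < μ) (hV : IsSecondVisitValue k μ V)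
    (ht : Touches k μ V L s 0) : L - s * μ = μ - k * μ ^ 2 := by
  have := ht.2.2
  rw [value_zero hμ0 hV] at this
  linarith

lemma left_eq_zero_of_touches_zero {e a b : ℝ} (hk : 0 < k) (hμ0 : 0 < μ) (hμ1 : μ < 1)
    (h4 : 4 * k * μ < 1) (hV : IsSecondVisitValue k μ V) (hL : IsUpperLine k μ V L s)
    (ht0 : Touches k μ V L s 0) (h : LearningPair k μ V e a b) (ht : Touches k μ V L s e) :
    2 * k * (b - a) < 1 ∧ a = 0 := by
  have h0 := intercept_of_touches_zero hμ0 hV ht0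
  have hwne : 2 * k * (b - a) ≠ 1 := by
    intro hw1
    obtain ⟨hs, hL', -⟩ := h.line_eq_of_width hk hV hL ht hw1
    rw [hs, hL'] at h0
    field_simp at h0
    nlinarith
  have hw := lt_of_le_of_ne h.two_mul_width_le hwne
  refine ⟨hw, ?_⟩
  by_contra ha0
  have ha : 0 < a := lt_of_le_of_ne h.nonneg (Ne.symm ha0)
  rcases h.le_one.eq_or_lt with hb1 | hb1
  · subst hb1
    have h5 := h.second_order_one hk hμ1 hV hL ha ht
    have h6 := h.left_eq ha
    have hi := h.intercept_eq hk hV hL ht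
    rw [h0] at hi
    obtain ⟨A, hA⟩ : ∃ A, A = 1 - a := ⟨_, rfl⟩
    obtain ⟨τ, hτ⟩ : ∃ τ, τ = 2 * k * A := ⟨_, rfl⟩
    obtain ⟨m, hm⟩ : ∃ m, m = 1 - μ := ⟨_, rfl⟩
    have ha' : a = 1 - A := by linarith
    have hμ' : μ = 1 - m := by linarith
    have hA0 : 0 < A := by linarith [h.left_lt_prior]
    have hmle : m ≤ A * τ ^ 2 := by
      rw [hτ, hm]; rw [← hA] at h5; linarith
    have he : e = 1 - A * τ / 2 := by
      rw [hτ]; rw [← hA] at h6; linarith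
    have hF := quadratic_pos_of_le hA0 (by rw [hτ]; positivity) (by rw [hτ, hA]; exact hw)
      (by linarith) hmle
    rw [← he, hτ] at hF
    rw [ha', hμ'] at hi
    nlinarith
  · exact hwne (h.width_eq_of_interior ha hb1)

/-- The heights at `0` read off from the contact points `0` and `e` agree. Together with the slope
this overdetermines `e` and `b`, which is the source of uniqueness. -/
lemma sq_eq_of_touches_zero {e b : ℝ} (hk : 0 < k) (hμ0 : 0 < μ)
    (hV : IsSecondVisitValue k μ V) (hL : IsUpperLine k μ V L s)
    (ht0 : Touches k μ V L s 0) (h : LearningPair k μ V e 0 b) (ht : Touches k μ V L s e) :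
    e ^ 2 = μ * (b - μ) := by
  have h0 := intercept_of_touches_zero hμ0 hV ht0
  have hi := h.intercept_eq hk hV hL ht
  have hb : 0 < b := by linarith [h.left_lt, h.lt_right]
  rw [h0] at hi
  refine mul_left_cancel₀ (a := b * k) (by positivity) ?_
  linear_combination -hi

lemma LearningPair.not_touches_one_and_lt_one {e₁ e₂ b : ℝ} (hk : 0 < k) (hμ0 : 0 < μ)
    (hV : IsSecondVisitValue k μ V) (hL : IsUpperLine k μ V L s)
    (ht0 : Touches k μ V L s 0) (h₁ : LearningPair k μ V e₁ 0 1) (ht₁ : Touches k μ V L s e₁)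
    (h₂ : LearningPair k μ V e₂ 0 b) (ht₂ : Touches k μ V L s e₂) (hb : b < 1) : False := by
  have s1 := sq_eq_of_touches_zero hk hμ0 hV hL ht0 h₁ ht₁
  have s2 := sq_eq_of_touches_zero hk hμ0 hV hL ht0 h₂ ht₂
  have l1 := h₁.slope_eq hk hV hL ht₁
  have l2 := h₂.slope_eq hk hV hL ht₂
  have r1 := h₁.right_le
  have r2 := h₂.right_eq hb
  have hd : 2 * k * b * (e₁ - e₂) = μ * (1 - b) := by linear_combination b * l1 - l2
  have hpos : 0 < μ * (1 - b) := mul_pos hμ0 (by linarith)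
  have hne : e₁ - e₂ ≠ 0 := by
    intro h0
    rw [h0] at hd
    linarith
  have hsum : e₁ + e₂ = 2 * k * b := by
    refine mul_left_cancel₀ hne ?_
    linear_combination s1 - s2 - hd
  have : 0 < k * (1 - b) ^ 2 := by
    have : 1 - b ≠ 0 := by linarith
    positivity
  nlinarith

lemma LearningPair.touches_unique {e₁ e₂ b₁ b₂ : ℝ} (hk : 0 < k) (hμ0 : 0 < μ)
    (hV : IsSecondVisitValue k μ V) (hL : IsUpperLine k μ V L s)
    (ht0 : Touches k μ V L s 0) (h₁ : LearningPair k μ V e₁ 0 b₁) (ht₁ : Touches k μ V L s e₁)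
    (h₂ : LearningPair k μ V e₂ 0 b₂) (ht₂ : Touches k μ V L s e₂) : e₁ = e₂ := by
  have s1 := sq_eq_of_touches_zero hk hμ0 hV hL ht0 h₁ ht₁
  have s2 := sq_eq_of_touches_zero hk hμ0 hV hL ht0 h₂ ht₂
  have p1 := h₁.left_lt
  have p2 := h₂.left_lt
  rcases h₁.le_one.eq_or_lt with hb1 | hb1
  · subst hb1
    rcases h₂.le_one.eq_or_lt with hb2 | hb2
    · subst hb2
      exact (pow_left_inj₀ p1.le p2.le two_ne_zero).1 (s1.trans s2.symm)
    · exact (h₁.not_touches_one_and_lt_one hk hμ0 hV hL ht0 ht₁ h₂ ht₂ hb2).elim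
  · rcases h₂.le_one.eq_or_lt with hb2 | hb2
    · subst hb2
      exact (h₂.not_touches_one_and_lt_one hk hμ0 hV hL ht0 ht₂ h₁ ht₁ hb1).elim
    · have l1 := h₁.slope_eq hk hV hL ht₁
      have l2 := h₂.slope_eq hk hV hL ht₂
      have r1 := h₁.right_eq hb1
      have r2 := h₂.right_eq hb2
      have e1 : e₁ = k * b₁ ^ 2 := by linarith
      have e2 : e₂ = k * b₂ ^ 2 := by linarith
      by_contra hne
      have hbne : b₁ - b₂ ≠ 0 := by
        intro h0
        refine hne ?_
        rw [e1, e2, sub_eq_zero.1 h0]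
      subst e1 e2
      have q1 : k ^ 2 * (b₁ + b₂) * (b₁ ^ 2 + b₂ ^ 2) = μ := by
        refine mul_left_cancel₀ hbne ?_
        linear_combination s1 - s2
      have q2 : 2 * k ^ 2 * b₁ * b₂ * (b₁ + b₂) = μ := by
        refine mul_left_cancel₀ hbne ?_
        linear_combination b₂ * l1 - b₁ * l2
      -- The heights give `q1`, the slopes `q2`; they are compatible only if the two upper
      -- posteriors coincide.
      have q3 : k ^ 2 * (b₁ + b₂) * (b₁ - b₂) ^ 2 = 0 := by linear_combination q1 - q2
      have hb10 : 0 < b₁ := h₁.left_lt.trans h₁.lt_right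
      have hb20 : 0 < b₂ := h₂.left_lt.trans h₂.lt_right
      have : 0 < k ^ 2 * (b₁ + b₂) * (b₁ - b₂) ^ 2 := by positivity
      linarith

/-- Strictness means that the lower posterior `0` is a strict corner, which leaves room to lower `b`
without disturbing it. The profitable deviation relies on this. -/
lemma LearningPair.left_lt_of_touches_zero {e b : ℝ} (hk : 0 < k) (hμ0 : 0 < μ) (hμ : μ ≤ 1 / 2)
    (h4 : 4 * k * μ < 1) (hV : IsSecondVisitValue k μ V) (hL : IsUpperLine k μ V L s)
    (ht0 : Touches k μ V L s 0) (h : LearningPair k μ V e 0 b) (ht : Touches k μ V L s e) :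
    k * b ^ 2 < b - e := by
  have s1 := sq_eq_of_touches_zero hk hμ0 hV hL ht0 h ht
  obtain ⟨hw, -⟩ := left_eq_zero_of_touches_zero hk hμ0 (by linarith) h4 hV hL ht0 h ht
  have hb : 0 < b := h.left_lt.trans h.lt_right
  rw [sub_zero] at hw
  rcases h.le_one.eq_or_lt with hb1 | hb1
  · subst hb1
    have he : e ≤ 1 / 2 := by
      have := h.left_lt
      nlinarith [sq_nonneg (μ - 1 / 2)]
    linarith
  · have := h.right_eq hb1
    nlinarith

/-- For a prior of at most `1/2` the line touches in exactly two points, one of which is `0`. -/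
theorem exists_touches_eq_of_le_half (hk : 0 < k) (hμ0 : 0 < μ) (hμ : μ ≤ 1 / 2)
    (hV : IsSecondVisitValue k μ V) (hL : IsUpperLine k μ V L s) (hVL : V μ < L) {c₀ e₀ : ℝ}
    (hcμ : c₀ < μ) (hμe : μ < e₀) (hc : Touches k μ V L s c₀) (he : Touches k μ V L s e₀) :
    ∃ e b, μ < e ∧ LearningPair k μ V e 0 b ∧ Touches k μ V L s 0 ∧ Touches k μ V L s e ∧
      (∀ x, Touches k μ V L s x → x = 0 ∨ x = e) ∧ k * b ^ 2 < b - e := by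
  have hμ1 : μ < 1 := by linarith
  have h4 := four_mul_lt_one hk hμ hμ0 hV hVL hcμ hμe hc he
  have hbelow : ∀ x, Touches k μ V L s x → x < μ → x = 0 := by
    intro c hc hcμ
    by_contra hc0
    have hc0 : 0 < c := lt_of_le_of_ne hc.1 (Ne.symm hc0)
    rcases hV.eq_or_pair c hc.1 hc.2.1 with h | ⟨a, b, h⟩
    · rcases hV.eq_or_pair e₀ he.1 he.2.1 with h' | ⟨a, b, h'⟩
      · have := le_of_touches_unvisited hV hcμ hμe hc he h h' hμ0.le hμ1.le
        linarith
      · exact no_unvisited_touch_below hk hμ1 h4 hV hL hc0 hcμ h hc h' hμe he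
    · exact no_interior_pair_below hk hμ0 hμ h4 hV hL h hcμ hc
  have ht0 : Touches k μ V L s 0 := hbelow c₀ hc hcμ ▸ hc
  have habove : ∀ x, Touches k μ V L s x → μ < x → ∃ b, LearningPair k μ V x 0 b := by
    intro x hx hμx
    rcases hV.eq_or_pair x hx.1 hx.2.1 with h' | ⟨a, b, h'⟩
    · have := le_of_touches_unvisited hV hμ0 hμx ht0 hx
        (by rw [value_zero hμ0 hV, max_eq_right hμ0.le]) h' hμ0.le hμ1.le
      linarith
    · obtain ⟨-, ha⟩ := left_eq_zero_of_touches_zero hk hμ0 hμ1 h4 hV hL ht0 h' hx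
      subst ha
      exact ⟨b, h'⟩
  obtain ⟨b, hb⟩ := habove e₀ he hμe
  refine ⟨e₀, b, hμe, hb, ht0, he, ?_, hb.left_lt_of_touches_zero hk hμ0 hμ h4 hV hL ht0 he⟩
  intro x hx
  rcases lt_trichotomy x μ with hxμ | hxμ | hxμ
  · exact Or.inl (hbelow x hx hxμ)
  · have := hx.2.2
    rw [hxμ] at this
    norm_num at this
    linarith
  · obtain ⟨b', hb'⟩ := habove x hx hxμ
    exact Or.inr (hb'.touches_unique hk hμ0 hV hL ht0 hx hb he)

/-- For a prior of at least `1/2` the line touches in exactly two points, one of which is `1`. -/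
theorem exists_touches_eq_of_half_le (hk : 0 < k) (hμ1 : μ < 1) (hμ : 1 / 2 ≤ μ)
    (hV : IsSecondVisitValue k μ V) (hL : IsUpperLine k μ V L s) (hVL : V μ < L) {c₀ e₀ : ℝ}
    (hcμ : c₀ < μ) (hμe : μ < e₀) (hc : Touches k μ V L s c₀) (he : Touches k μ V L s e₀) :
    ∃ c a, c < μ ∧ LearningPair k μ V c a 1 ∧ Touches k μ V L s 1 ∧ Touches k μ V L s c ∧
      (∀ x, Touches k μ V L s x → x = c ∨ x = 1) := by
  have hV2 : (fun x => (fun x => V (1 - x) + x - μ) (1 - x) + x - (1 - μ)) = V := by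
    funext x; simp only [sub_sub_cancel]; ring
  obtain ⟨e, b, h1, h2, h3, h4, h5, -⟩ := exists_touches_eq_of_le_half hk (sub_pos.2 hμ1)
    (by linarith) hV.reflect hL.reflect
    (by simp only [sub_sub_cancel]; linarith) (sub_lt_sub_left hμe 1) (sub_lt_sub_left hcμ 1)
    he.reflect hc.reflect
  have hL2 : L + 1 - 2 * μ + 1 - 2 * (1 - μ) = L := by ring
  have h2' := h2.reflect
  have h3' := h3.reflect
  have h4' := h4.reflect
  rw [hV2, sub_sub_cancel, sub_zero] at h2' h3'
  rw [hV2, sub_sub_cancel] at h4'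
  rw [hL2, sub_sub_cancel] at h3' h4'
  refine ⟨1 - e, 1 - b, by linarith, h2', h3', h4', ?_⟩
  intro x hx
  rcases h5 _ hx.reflect with h | h
  · right; linarith
  · left; linarith


end

/-! ### Offers as measures: two-point offers, garblings and supporting lines -/

noncomputable section

lemma integrable_of_measurable_of_bounded {ν : Measure unitInterval} [IsFiniteMeasure ν]
    {f : unitInterval → ℝ} (hf : Measurable f) {C : ℝ} (hC : ∀ x, |f x| ≤ C) : Integrable f ν :=
  Integrable.of_bound hf.aestronglyMeasurable C (Filter.Eventually.of_forall hC)

lemma integrable_of_continuous {ν : Measure unitInterval} [IsFiniteMeasure ν]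
    {f : unitInterval → ℝ} (hf : Continuous f) : Integrable f ν := by
  obtain ⟨C, hC⟩ := isCompact_univ.exists_bound_of_continuousOn hf.continuousOn
  exact Integrable.of_bound hf.aestronglyMeasurable C
    (Filter.Eventually.of_forall fun x => hC x (Set.mem_univ x))

section

variable {k μ : ℝ}

lemma Offer.ext_law {p q : Offer μ} (h : p.law = q.law) : p = q :=
  Subtype.ext (Subtype.ext h)

lemma Offer.integral_coe (p : Offer μ) : ∫ x, (x : ℝ) ∂p.law = μ := p.2

lemma Offer.integrable_coe (p : Offer μ) : Integrable (fun x : unitInterval => (x : ℝ)) p.law :=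
  integrable_of_continuous continuous_subtype_val

lemma Offer.integrable_line (p : Offer μ) (C s : ℝ) :
    Integrable (fun x : unitInterval => C + s * ((x : ℝ) - μ)) p.law :=
  integrable_of_continuous (by fun_prop)

lemma Offer.integral_line (p : Offer μ) (C s : ℝ) :
    ∫ x : unitInterval, (C + s * ((x : ℝ) - μ)) ∂p.law = C := by
  have h : Integrable (fun x : unitInterval => s * ((x : ℝ) - μ)) p.law :=
    integrable_of_continuous (by fun_prop)
  rw [integral_add (integrable_const _) h, integral_const_mul,
    integral_sub p.integrable_coe (integrable_const _), p.integral_coe]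
  simp

lemma IsGarbling.refl (p : Offer μ) : IsGarbling p p := fun _ _ _ => le_rfl

/-- The two-point offer with posteriors `l < μ < h`. -/
def binaryOffer (l h : unitInterval) (hl : (l : ℝ) < μ) (hh : μ < h) : Offer μ :=
  ⟨⟨ENNReal.ofReal ((h - μ) / (h - l)) • Measure.dirac l +
      ENNReal.ofReal ((μ - l) / (h - l)) • Measure.dirac h, by
    constructor
    have h1 : 0 < (h : ℝ) - l := by linarith
    simp only [Measure.coe_add, Measure.coe_smul, Pi.add_apply, Pi.smul_apply, measure_univ,
      smul_eq_mul, mul_one]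
    rw [← ENNReal.ofReal_add (div_nonneg (by linarith) h1.le) (div_nonneg (by linarith) h1.le),
      ← add_div]
    rw [show (h : ℝ) - μ + (μ - l) = h - l by ring, div_self h1.ne', ENNReal.ofReal_one]⟩, by
    have h1 : 0 < (h : ℝ) - l := by linarith
    simp only [ProbabilityMeasure.coe_mk]
    rw [integral_add_measure ((integrable_dirac (by simp)).smul_measure ENNReal.ofReal_ne_top)
      ((integrable_dirac (by simp)).smul_measure ENNReal.ofReal_ne_top), integral_smul_measure,
      integral_smul_measure, integral_dirac, integral_dirac,
      ENNReal.toReal_ofReal (div_nonneg (by linarith) h1.le),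
      ENNReal.toReal_ofReal (div_nonneg (by linarith) h1.le)]
    simp only [smul_eq_mul]
    field_simp
    ring⟩

lemma binaryOffer_law (l h : unitInterval) (hl : (l : ℝ) < μ) (hh : μ < h) :
    (binaryOffer l h hl hh).law = ENNReal.ofReal ((h - μ) / (h - l)) • Measure.dirac l +
      ENNReal.ofReal ((μ - l) / (h - l)) • Measure.dirac h := rfl

lemma integral_binaryOffer (l h : unitInterval) (hl : (l : ℝ) < μ) (hh : μ < h)
    (f : unitInterval → ℝ) :
    ∫ x, f x ∂(binaryOffer l h hl hh).law =
      (h - μ) / (h - l) * f l + (μ - l) / (h - l) * f h := by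
  have h1 : 0 < (h : ℝ) - l := by linarith
  rw [binaryOffer_law, integral_add_measure
    ((integrable_dirac (by simp)).smul_measure ENNReal.ofReal_ne_top)
      ((integrable_dirac (by simp)).smul_measure ENNReal.ofReal_ne_top), integral_smul_measure,
      integral_smul_measure, integral_dirac, integral_dirac,
      ENNReal.toReal_ofReal (div_nonneg (by linarith) h1.le),
      ENNReal.toReal_ofReal (div_nonneg (by linarith) h1.le)]
  rfl

lemma of_ae_binaryOffer (l h : unitInterval) (hl : (l : ℝ) < μ) (hh : μ < h)
    {P : unitInterval → Prop} (hP : ∀ᵐ x : unitInterval ∂(binaryOffer l h hl hh).law, P x) : P l ∧ P h := by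
  have h1 : 0 < (h : ℝ) - l := by linarith
  have h2 : 0 < ((h : ℝ) - μ) / (h - l) := div_pos (by linarith) h1
  have h3 : 0 < (μ - (l : ℝ)) / (h - l) := div_pos (by linarith) h1
  rw [binaryOffer_law, ae_add_measure_iff, Measure.ae_ennreal_smul_measure_iff (by simpa using h2),
    Measure.ae_ennreal_smul_measure_iff (by simpa using h3), ae_dirac_eq, ae_dirac_eq] at hP
  exact hP

lemma ae_binaryOffer (l h : unitInterval) (hl : (l : ℝ) < μ) (hh : μ < h) :
    ∀ᵐ x : unitInterval ∂(binaryOffer l h hl hh).law, x = l ∨ x = h := by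
  have h1 : 0 < (h : ℝ) - l := by linarith
  have h2 : 0 < ((h : ℝ) - μ) / (h - l) := div_pos (by linarith) h1
  have h3 : 0 < (μ - (l : ℝ)) / (h - l) := div_pos (by linarith) h1
  rw [binaryOffer_law, ae_add_measure_iff, Measure.ae_ennreal_smul_measure_iff (by simpa using h2),
    Measure.ae_ennreal_smul_measure_iff (by simpa using h3), ae_dirac_eq, ae_dirac_eq]
  exact ⟨Or.inl rfl, Or.inr rfl⟩

lemma eq_binaryOffer {q : Offer μ} {l h : unitInterval} (hl : (l : ℝ) < μ) (hh : μ < h)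
    (hq : ∀ᵐ x : unitInterval ∂q.law, x = l ∨ x = h) : q = binaryOffer l h hl hh := by
  have hlh : l ≠ h := by
    rintro rfl; linarith
  have h1 : 0 < (h : ℝ) - l := by linarith
  have hr : q.law = q.law {l} • Measure.dirac l + q.law {h} • Measure.dirac h := by
    have h2 : q.law.restrict ({l} ∪ {h}) = q.law :=
      Measure.restrict_eq_self_of_ae_mem hq
    rw [Measure.restrict_union (by simpa using hlh) (measurableSet_singleton h),
      Measure.restrict_singleton, Measure.restrict_singleton] at h2
    exact h2.symm
  have hint : ∀ f : unitInterval → ℝ, ∫ x, f x ∂q.law =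
      (q.law {l}).toReal * f l + (q.law {h}).toReal * f h := by
    intro f
    conv_lhs => rw [hr]
    rw [integral_add_measure
      ((integrable_dirac (by simp)).smul_measure (measure_ne_top _ _))
      ((integrable_dirac (by simp)).smul_measure (measure_ne_top _ _)), integral_smul_measure,
      integral_smul_measure, integral_dirac, integral_dirac]
    rfl
  have e1 := hint fun _ => 1
  have e2 := hint fun x => x
  rw [q.integral_coe] at e2
  simp only [integral_const, probReal_univ, smul_eq_mul, mul_one] at e1
  have w1 : (q.law {l}).toReal = (h - μ) / (h - l) := by
    rw [eq_div_iff h1.ne']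
    linear_combination (h : ℝ) * (-e1) + e2
  have w2 : (q.law {h}).toReal = (μ - l) / (h - l) := by
    rw [eq_div_iff h1.ne']
    linear_combination (l : ℝ) * e1 - e2
  refine Offer.ext_law ?_
  rw [binaryOffer_law, ← w1, ← w2, ENNReal.ofReal_toReal (measure_ne_top _ _),
    ENNReal.ofReal_toReal (measure_ne_top _ _)]
  exact hr

/-- The offer that reveals nothing. -/
def priorOffer (hμ0 : 0 ≤ μ) (hμ1 : μ ≤ 1) : Offer μ :=
  ⟨⟨Measure.dirac ⟨μ, hμ0, hμ1⟩, inferInstance⟩, by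
    simp only [ProbabilityMeasure.coe_mk]
    rw [integral_dirac]⟩

lemma integral_priorOffer (hμ0 : 0 ≤ μ) (hμ1 : μ ≤ 1) (f : unitInterval → ℝ) :
    ∫ x, f x ∂(priorOffer hμ0 hμ1).law = f ⟨μ, hμ0, hμ1⟩ :=
  integral_dirac _ _

/-- Every offer is a garbling of a two-point offer between whose posteriors it is supported. -/
lemma isGarbling_binaryOffer {q : Offer μ} {l h : unitInterval} (hl : (l : ℝ) < μ) (hh : μ < h)
    (hq : ∀ᵐ x : unitInterval ∂q.law, (l : ℝ) ≤ x ∧ (x : ℝ) ≤ h) : IsGarbling q (binaryOffer l h hl hh) := by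
  intro u hu hc
  have h1 : 0 < (h : ℝ) - l := by linarith
  rw [integral_binaryOffer]
  have hm : Measurable fun x : unitInterval => u x := hu.measurable.comp measurable_subtype_coe
  have hi : Integrable (fun x : unitInterval => u x) q.law := by
    refine integrable_of_measurable_of_bounded hm (C := max |u 0| |u 1|) fun x => ?_
    exact abs_le_max_abs_abs (hu x.2.1) (hu x.2.2)
  rw [← q.integral_line ((h - μ) / (h - l) * u l + (μ - l) / (h - l) * u h)
    ((u h - u l) / (h - l))]
  refine integral_mono_ae ?_ hi ?_
  · exact q.integrable_line _ _
  · filter_upwards [hq] with x hx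
    have w1 : 0 ≤ ((h : ℝ) - x) / (h - l) := div_nonneg (by linarith) h1.le
    have w2 : 0 ≤ ((x : ℝ) - l) / (h - l) := div_nonneg (by linarith) h1.le
    have := hc.2 (Set.mem_univ (l : ℝ)) (Set.mem_univ (h : ℝ)) w1 w2
      (by rw [← add_div]; field_simp; ring)
    simp only [smul_eq_mul] at this
    have e : ((h : ℝ) - x) / (h - l) * l + (x - l) / (h - l) * h = x := by field_simp; ring
    rw [e] at this
    refine le_trans (le_of_eq ?_) this
    field_simp
    ring

lemma isGarbling_priorOffer (hμ0 : 0 ≤ μ) (hμ1 : μ ≤ 1) (p : Offer μ) :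
    IsGarbling (priorOffer hμ0 hμ1) p := by
  intro u hu hc
  rw [integral_priorOffer]
  have hcont : Continuous u := by
    have := hc.continuousOn isOpen_univ
    rwa [continuousOn_univ] at this
  have hi : Integrable (fun x : unitInterval => u x) p.law :=
    integrable_of_continuous (hcont.comp continuous_subtype_val)
  have := hc.le_map_integral (μ := p.law) (f := fun x : unitInterval => (x : ℝ)) hcont.continuousOn isClosed_univ
    (by simp) p.integrable_coe hi
  rw [p.integral_coe] at this
  exact this

/-- A garbling of a two-point offer is supported between its posteriors. -/
lemma IsGarbling.ae_mem {q : Offer μ} {l h : unitInterval} {hl : (l : ℝ) < μ} {hh : μ < h}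
    (hq : IsGarbling q (binaryOffer l h hl hh)) :
    ∀ᵐ x : unitInterval ∂q.law, (l : ℝ) ≤ x ∧ (x : ℝ) ≤ h := by
  have h1 : 0 < (h : ℝ) - l := by linarith
  have key : ∀ c : ℝ, Integrable (fun x : unitInterval => min (x : ℝ) c) q.law := fun c =>
    integrable_of_continuous (continuous_subtype_val.min continuous_const)
  have hmon : ∀ c : ℝ, Monotone fun x : ℝ => min x c := fun c x y hxy => min_le_min_right c hxy
  have hconc : ∀ c : ℝ, ConcaveOn ℝ Set.univ fun x : ℝ => min x c := fun c =>
    (concaveOn_id convex_univ).inf (concaveOn_const c convex_univ)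
  -- The test functions `min · l` and `min · h` detect mass below `l` and above `h`.
  have hA := hq _ (hmon l) (hconc l)
  have hB := hq _ (hmon h) (hconc h)
  rw [integral_binaryOffer, min_self, min_eq_right (by linarith)] at hA
  rw [integral_binaryOffer, min_self, min_eq_left (by linarith)] at hB
  have e1 : ((h : ℝ) - μ) / (h - l) * l + (μ - l) / (h - l) * l = l := by field_simp; ring
  have e2 : ((h : ℝ) - μ) / (h - l) * l + (μ - l) / (h - l) * h = μ := by field_simp; ring
  rw [e1] at hA
  rw [e2] at hB
  have hA' : ∀ᵐ x : unitInterval ∂q.law, (l : ℝ) - min (x : ℝ) l = 0 := by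
    refine (integral_eq_zero_iff_of_nonneg (fun x => sub_nonneg.2 (min_le_right _ _))
      ((integrable_const _).sub (key l))).1 ?_
    refine le_antisymm ?_ (integral_nonneg fun x => sub_nonneg.2 (min_le_right _ _))
    rw [integral_sub (integrable_const _) (key l)]
    simpa using hA
  have hB' : ∀ᵐ x : unitInterval ∂q.law, (x : ℝ) - min (x : ℝ) h = 0 := by
    refine (integral_eq_zero_iff_of_nonneg (fun x => sub_nonneg.2 (min_le_left _ _))
      (q.integrable_coe.sub (key h))).1 ?_
    refine le_antisymm ?_ (integral_nonneg fun x => sub_nonneg.2 (min_le_left _ _))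
    rw [integral_sub q.integrable_coe (key h), q.integral_coe]
    simpa using hB
  filter_upwards [hA', hB'] with x h1 h2
  constructor
  · have := min_le_left (x : ℝ) l; linarith
  · have := min_le_right (x : ℝ) h; linarith

/-- Complementary slackness: an affine function integrates to its value at the mean, so the
nonnegative gap has integral zero. -/
lemma Offer.ae_eq_line (q : Offer μ) {f : unitInterval → ℝ} {C s : ℝ} (hf : Integrable f q.law)
    (hle : ∀ᵐ x : unitInterval ∂q.law, f x ≤ C + s * ((x : ℝ) - μ)) (hC : C ≤ ∫ x, f x ∂q.law) :
    ∀ᵐ x : unitInterval ∂q.law, f x = C + s * ((x : ℝ) - μ) := by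
  have hl := q.integrable_line C s
  have h0 : 0 ≤ᵐ[q.law] fun x : unitInterval => C + s * ((x : ℝ) - μ) - f x := by
    filter_upwards [hle] with x hx using sub_nonneg.2 hx
  have h1 : ∫ x, (C + s * ((x : ℝ) - μ) - f x) ∂q.law = 0 := by
    refine le_antisymm ?_ (integral_nonneg_of_ae h0)
    rw [integral_sub hl hf, q.integral_line]
    linarith
  filter_upwards [(integral_eq_zero_iff_of_nonneg_ae h0 (hl.sub hf)).1 h1] with x hx
  simp only [Pi.zero_apply] at hx
  linarith

/-- Two-point offers suffice for concavification in one dimension. The slope is the supremum of the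
quotients to the right of `μ`, which the hypothesis bounds by every quotient to the left. -/
lemma exists_upper_line {f : ℝ → ℝ} {C : ℝ} (hμ0 : 0 < μ) (hμ1 : μ < 1) (hp : f μ ≤ C)
    (hc : ∀ a b, 0 ≤ a → a < μ → μ < b → b ≤ 1 → (b - μ) * f a + (μ - a) * f b ≤ (b - a) * C) :
    ∃ s, ∀ x, 0 ≤ x → x ≤ 1 → f x ≤ C + s * (x - μ) := by
  set S : Set ℝ := (fun b => (f b - C) / (b - μ)) '' Set.Ioc μ 1
  have hub : ∀ a, 0 ≤ a → a < μ → (C - f a) / (μ - a) ∈ upperBounds S := by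
    rintro a ha haμ _ ⟨b, ⟨hμb, hb⟩, rfl⟩
    have := hc a b ha haμ hμb hb
    rw [div_le_div_iff₀ (by linarith) (by linarith)]
    nlinarith
  have hne : S.Nonempty := ⟨_, 1, ⟨hμ1, le_rfl⟩, rfl⟩
  refine ⟨sSup S, fun x hx0 hx1 => ?_⟩
  rcases lt_trichotomy x μ with hx | rfl | hx
  · have := csSup_le hne (hub x hx0 hx)
    rw [le_div_iff₀ (by linarith)] at this
    linarith
  · simpa using hp
  · have : (f x - C) / (x - μ) ≤ sSup S :=
      le_csSup ⟨_, hub 0 le_rfl hμ0⟩ ⟨x, ⟨hx, hx1⟩, rfl⟩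
    rw [div_le_iff₀ (by linarith)] at this
    linarith

/-- A distribution with mean `μ` that avoids `μ` must charge both sides of it. -/
lemma Offer.exists_lt_gt (q : Offer μ) (hμ0 : 0 ≤ μ) (hμ1 : μ ≤ 1) {P : unitInterval → Prop}
    (hP : ∀ᵐ x : unitInterval ∂q.law, P x) (hμ : ¬ P ⟨μ, hμ0, hμ1⟩) :
    (∃ a, P a ∧ (a : ℝ) < μ) ∧ ∃ b, P b ∧ μ < (b : ℝ) := by
  constructor
  · by_contra! h
    have h1 : ∀ᵐ x : unitInterval ∂q.law, μ = μ + 1 * ((x : ℝ) - μ) := by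
      refine q.ae_eq_line (integrable_const _) ?_ (by simp)
      filter_upwards [hP] with x hx
      linarith [h x hx]
    obtain ⟨x, hx, hx'⟩ := (hP.and h1).exists
    have : x = ⟨μ, hμ0, hμ1⟩ := Subtype.ext (by simp only; linarith)
    exact hμ (this ▸ hx)
  · by_contra! h
    have h1 : ∀ᵐ x : unitInterval ∂q.law, (x : ℝ) = μ + 0 * ((x : ℝ) - μ) := by
      refine q.ae_eq_line q.integrable_coe ?_ q.integral_coe.ge
      filter_upwards [hP] with x hx
      linarith [h x hx]
    obtain ⟨x, hx, hx'⟩ := (hP.and h1).exists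
    have : x = ⟨μ, hμ0, hμ1⟩ := Subtype.ext (by simp only; linarith)
    exact hμ (this ▸ hx)

end


/-! ### Optimal learning at the second sender -/

lemma nonneg_of_forall_small_quadratic_nonneg {k m ε : ℝ} (hk : 0 < k) (hε : 0 < ε)
    (h : ∀ t, 0 < t → t < ε → 0 ≤ m * t + k * t ^ 2) : 0 ≤ m := by
  by_contra! hm
  have h0 : 0 < min (ε / 2) (-m / (2 * k)) :=
    lt_min (by linarith) (div_pos (by linarith) (by linarith))
  set t := min (ε / 2) (-m / (2 * k)) with ht
  have h1 : t ≤ ε / 2 := min_le_left _ _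
  have h2 : t ≤ -m / (2 * k) := min_le_right _ _
  rw [le_div_iff₀ (by linarith)] at h2
  have := h t h0 (by linarith)
  nlinarith

section

variable {k μ : ℝ}

/-- A line above `y ↦ max x y - k (y - μ) ^ 2` meets it at most once on either side of `x`. -/
lemma eq_of_touch_same_side {x C s y z : ℝ} (hk : 0 < k)
    (hline : ∀ y, 0 ≤ y → y ≤ 1 → max x y - k * (y - μ) ^ 2 ≤ C + s * (y - μ))
    (hy0 : 0 ≤ y) (hy1 : y ≤ 1) (hz0 : 0 ≤ z) (hz1 : z ≤ 1)
    (hy : max x y - k * (y - μ) ^ 2 = C + s * (y - μ))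
    (hz : max x z - k * (z - μ) ^ 2 = C + s * (z - μ))
    (h : (y ≤ x ∧ z ≤ x) ∨ (x ≤ y ∧ x ≤ z)) : y = z := by
  -- On one side of `x` the function is strictly concave, so two contacts would put their midpoint
  -- above the line.
  have hm := hline ((y + z) / 2) (by linarith) (by linarith)
  have hs : k * (y - z) ^ 2 ≤ 0 := by
    rcases h with ⟨h1, h2⟩ | ⟨h1, h2⟩
    · rw [max_eq_left h1] at hy
      rw [max_eq_left h2] at hz
      rw [max_eq_left (by linarith)] at hm
      nlinarith
    · rw [max_eq_right h1] at hy
      rw [max_eq_right h2] at hz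
      rw [max_eq_right (by linarith)] at hm
      nlinarith
  by_contra hne
  have : y - z ≠ 0 := sub_ne_zero.2 hne
  have : 0 < k * (y - z) ^ 2 := by positivity
  linarith

lemma learningPair_of_touch {V : ℝ → ℝ} {x s a b : ℝ} (hk : 0 < k)
    (hline : ∀ y, 0 ≤ y → y ≤ 1 → max x y - k * (y - μ) ^ 2 ≤ V x + s * (y - μ))
    (ha0 : 0 ≤ a) (haμ : a < μ) (hμb : μ < b) (hb1 : b ≤ 1)
    (ha : max x a - k * (a - μ) ^ 2 = V x + s * (a - μ))
    (hb : max x b - k * (b - μ) ^ 2 = V x + s * (b - μ)) : LearningPair k μ V x a b := by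
  have hN : 0 < b - a := by linarith
  have hax : a < x := by
    by_contra! h
    have := eq_of_touch_same_side hk hline ha0 (by linarith) (by linarith) hb1 ha hb
      (Or.inr ⟨h, by linarith⟩)
    linarith
  have hxb : x < b := by
    by_contra! h
    have := eq_of_touch_same_side hk hline ha0 (by linarith) (by linarith) hb1 ha hb
      (Or.inl ⟨by linarith, h⟩)
    linarith
  rw [max_eq_left hax.le] at ha
  rw [max_eq_right hxb.le] at hb
  have hkN : 0 < k * (b - a) := by positivity
  -- The gap at a perturbed posterior, scaled by `b - a`. The sign of its linear coefficient is the
  -- tangency condition, an equality when the posterior can move both ways.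
  have hleft : ∀ t, -a ≤ t → t ≤ x - a →
      0 ≤ ((b - x) - k * (b - a) ^ 2) * t + k * (b - a) * t ^ 2 := by
    intro t h1 h2
    have := hline (a + t) (by linarith) (by linarith)
    rw [max_eq_left (by linarith)] at this
    have := mul_le_mul_of_nonneg_left this hN.le
    linear_combination this - (b - a - t) * ha - t * hb
  have hright : ∀ t, -(1 - b) ≤ t → t ≤ b - x →
      0 ≤ ((x - a) - k * (b - a) ^ 2) * t + k * (b - a) * t ^ 2 := by
    intro t h1 h2
    have := hline (b - t) (by linarith) (by linarith)
    rw [max_eq_right (by linarith)] at this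
    have := mul_le_mul_of_nonneg_left this hN.le
    linear_combination this - t * ha - (b - a - t) * hb
  refine ⟨ha0, hax, hxb, hb1, haμ, hμb, ?_, ?_, ?_, ?_, ?_⟩
  · linear_combination -(b - μ) * ha - (μ - a) * hb
  · have := nonneg_of_forall_small_quadratic_nonneg hkN (sub_pos.2 hax)
      fun t h1 h2 => hleft t (by linarith) h2.le
    linarith
  · intro ha
    have := eq_zero_of_forall_small_quadratic_nonneg hkN (lt_min ha (sub_pos.2 hax))
      fun t h1 h2 => hleft t (by linarith [min_le_left a (x - a)])
        (by linarith [min_le_right a (x - a)])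
    linarith
  · have := nonneg_of_forall_small_quadratic_nonneg hkN (sub_pos.2 hxb)
      fun t h1 h2 => hright t (by linarith) h2.le
    linarith
  · intro hb
    have := eq_zero_of_forall_small_quadratic_nonneg hkN (lt_min (sub_pos.2 hb) (sub_pos.2 hxb))
      fun t h1 h2 => hright t (by linarith [min_le_left (1 - b) (b - x)])
        (by linarith [min_le_right (1 - b) (b - x)])
    linarith

/-- The value of a visit to the second sender after the belief `x` if every offer is feasible. -/
def secondVisitValue (k μ x : ℝ) : ℝ :=
  ⨆ q : Offer μ, ∫ y, (max x (y : ℝ) - k * ((y : ℝ) - μ) ^ 2) ∂q.law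

lemma continuous_secondVisit_integrand (k μ x : ℝ) :
    Continuous fun y : unitInterval => max x (y : ℝ) - k * ((y : ℝ) - μ) ^ 2 := by
  fun_prop

lemma secondVisitPayoff_eq (k μ : ℝ) (x : unitInterval) (q : Offer μ) :
    secondVisitPayoff k μ x q =
      ∫ y : unitInterval, (max (x : ℝ) (y : ℝ) - k * ((y : ℝ) - μ) ^ 2) ∂q.law := rfl

lemma secondVisitPayoff_le_one (hk : 0 < k) (x : unitInterval) (q : Offer μ) :
    secondVisitPayoff k μ x q ≤ 1 := by
  rw [secondVisitPayoff_eq, ← q.integral_line 1 0]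
  refine integral_mono (integrable_of_continuous (continuous_secondVisit_integrand _ _ _))
    (q.integrable_line _ _) fun y => ?_
  have h1 := max_le x.2.2 y.2.2
  have h2 : 0 ≤ k * ((y : ℝ) - μ) ^ 2 := by positivity
  simp only [zero_mul, add_zero]
  linarith

lemma abs_secondVisitPayoff_le (hk : 0 < k) (hμ0 : 0 < μ) (hμ1 : μ < 1) (x : unitInterval)
    (q : Offer μ) : |secondVisitPayoff k μ x q| ≤ 1 + k := by
  rw [abs_le]
  refine ⟨?_, (secondVisitPayoff_le_one hk x q).trans (by linarith)⟩
  rw [secondVisitPayoff_eq, ← q.integral_line (-(1 + k)) 0]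
  refine integral_mono (q.integrable_line _ _)
    (integrable_of_continuous (continuous_secondVisit_integrand _ _ _)) fun y => ?_
  have h1 : (0 : ℝ) ≤ max (x : ℝ) (y : ℝ) := le_max_of_le_left x.2.1
  have h2 : ((y : ℝ) - μ) ^ 2 ≤ 1 := by
    have := y.2.1; have := y.2.2
    nlinarith
  have h3 : k * ((y : ℝ) - μ) ^ 2 ≤ k * 1 := by gcongr
  simp only [zero_mul, add_zero]
  linarith

/-- `q` is optimal at the second sender after the belief `x` if every offer is feasible. -/
def IsBestSecond (k : ℝ) (x : unitInterval) (q : Offer μ) : Prop :=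
  ∀ q', secondVisitPayoff k μ x q' ≤ secondVisitPayoff k μ x q

lemma IsBestSecond.payoff_eq {x : unitInterval} {q : Offer μ} (h : IsBestSecond k x q) :
    secondVisitPayoff k μ x q = secondVisitValue k μ x := by
  have : Nonempty (Offer μ) := ⟨q⟩
  refine le_antisymm (le_ciSup (f := fun q : Offer μ =>
    ∫ y, (max (x : ℝ) (y : ℝ) - k * ((y : ℝ) - μ) ^ 2) ∂q.law)
    ⟨secondVisitPayoff k μ x q, ?_⟩ q) (ciSup_le h)
  rintro _ ⟨q', rfl⟩
  exact h q'

lemma secondVisitPayoff_priorOffer (hμ0 : 0 ≤ μ) (hμ1 : μ ≤ 1) (x : unitInterval) :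
    secondVisitPayoff k μ x (priorOffer hμ0 hμ1) = max (x : ℝ) μ := by
  rw [secondVisitPayoff_eq, integral_priorOffer]
  simp

lemma secondVisitPayoff_binaryOffer (x l h : unitInterval) (hl : (l : ℝ) < μ) (hh : μ < h) :
    ((h : ℝ) - l) * secondVisitPayoff k μ x (binaryOffer l h hl hh) =
      (h - μ) * (max (x : ℝ) l - k * (l - μ) ^ 2) +
        (μ - l) * (max (x : ℝ) h - k * (h - μ) ^ 2) := by
  have h1 : 0 < (h : ℝ) - l := by linarith
  rw [secondVisitPayoff_eq, integral_binaryOffer]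
  field_simp

/-- An optimal draw lives on contact points of a supporting line, and there is at most one on either
side of `x`. If the prior is a contact point, learning nothing is optimal as well. -/
lemma IsBestSecond.eq_or_binaryOffer (hk : 0 < k) (hμ0 : 0 < μ) (hμ1 : μ < 1) {x : unitInterval}
    {q : Offer μ} (h : IsBestSecond k x q) :
    secondVisitValue k μ x = max (x : ℝ) μ ∨
      ∃ (a b : unitInterval) (ha : (a : ℝ) < μ) (hb : μ < b),
        LearningPair k μ (secondVisitValue k μ) x a b ∧ q = binaryOffer a b ha hb := by
  obtain ⟨s, hs⟩ := exists_upper_line (f := fun y => max (x : ℝ) y - k * (y - μ) ^ 2)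
    (C := secondVisitValue k μ x) hμ0 hμ1 (by
      have := h (priorOffer hμ0.le hμ1.le)
      rw [secondVisitPayoff_priorOffer, h.payoff_eq] at this
      simpa using this) (by
      intro a b ha0 haμ hμb hb1
      have h1 := h (binaryOffer ⟨a, ha0, by linarith⟩ ⟨b, by linarith, hb1⟩ haμ hμb)
      rw [h.payoff_eq] at h1
      have h2 := secondVisitPayoff_binaryOffer (k := k) x ⟨a, ha0, by linarith⟩
        ⟨b, by linarith, hb1⟩ haμ hμb
      have h3 := mul_le_mul_of_nonneg_left h1 (sub_nonneg.2 (haμ.trans hμb).le)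
      rw [← h2]
      exact h3)
  have hae := q.ae_eq_line (integrable_of_continuous (continuous_secondVisit_integrand k μ x))
    (Filter.Eventually.of_forall fun y : unitInterval => hs y y.2.1 y.2.2) h.payoff_eq.ge
  by_cases hm : max (x : ℝ) μ - k * (μ - μ) ^ 2 = secondVisitValue k μ x + s * (μ - μ)
  · left
    simpa using hm.symm
  · right
    obtain ⟨⟨a, ha, haμ⟩, b, hb, hμb⟩ := q.exists_lt_gt hμ0.le hμ1.le hae hm
    have hp := learningPair_of_touch hk hs a.2.1 haμ hμb b.2.2 ha hb
    refine ⟨a, b, haμ, hμb, hp, eq_binaryOffer haμ hμb ?_⟩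
    filter_upwards [hae] with y hy
    rcases le_total (y : ℝ) x with hyx | hyx
    · left
      exact Subtype.ext (eq_of_touch_same_side hk hs y.2.1 y.2.2 a.2.1 a.2.2 hy ha
        (Or.inl ⟨hyx, hp.left_lt.le⟩))
    · right
      exact Subtype.ext (eq_of_touch_same_side hk hs y.2.1 y.2.2 b.2.1 b.2.2 hy hb
        (Or.inr ⟨hyx, hp.lt_right.le⟩))

lemma isSecondVisitValue (hk : 0 < k) (hμ0 : 0 < μ) (hμ1 : μ < 1)
    (h : ∀ x : unitInterval, ∃ q : Offer μ, IsBestSecond k x q) :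
    IsSecondVisitValue k μ (secondVisitValue k μ) := by
  refine ⟨?_, ?_, ?_⟩
  · intro x a b hx0 hx1 ha0 haμ hμb hb1
    obtain ⟨q, hq⟩ := h ⟨x, hx0, hx1⟩
    have h1 := hq (binaryOffer ⟨a, ha0, by linarith⟩ ⟨b, by linarith, hb1⟩ haμ hμb)
    rw [hq.payoff_eq] at h1
    have h2 := secondVisitPayoff_binaryOffer (k := k) ⟨x, hx0, hx1⟩ ⟨a, ha0, by linarith⟩
      ⟨b, by linarith, hb1⟩ haμ hμb
    have h3 := mul_le_mul_of_nonneg_left h1 (sub_nonneg.2 (haμ.trans hμb).le)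
    exact h2.ge.trans h3
  · intro x hx0 hx1
    obtain ⟨q, hq⟩ := h ⟨x, hx0, hx1⟩
    have := hq (priorOffer hμ0.le hμ1.le)
    rwa [secondVisitPayoff_priorOffer, hq.payoff_eq] at this
  · intro x hx0 hx1
    obtain ⟨q, hq⟩ := h ⟨x, hx0, hx1⟩
    rcases hq.eq_or_binaryOffer hk hμ0 hμ1 with h1 | ⟨a, b, -, -, h1, -⟩
    · exact Or.inl h1
    · exact Or.inr ⟨a, b, h1⟩

/-- Learning about the second sender is useless if the first sender's belief is below every
feasible posterior. -/
lemma Offer.ae_eq_prior_of_le {q : Offer μ} {x : unitInterval} (hk : 0 < k)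
    (hq : ∀ᵐ y : unitInterval ∂q.law, (x : ℝ) ≤ y) (h : μ ≤ secondVisitPayoff k μ x q) :
    ∀ᵐ y : unitInterval ∂q.law, (y : ℝ) = μ := by
  have := q.ae_eq_line (C := μ) (s := 1)
    (integrable_of_continuous (continuous_secondVisit_integrand k μ x)) (by
      filter_upwards [hq] with y hy
      rw [max_eq_right hy]
      have : 0 ≤ k * ((y : ℝ) - μ) ^ 2 := by positivity
      linarith) h
  filter_upwards [this, hq] with y hy hxy
  rw [max_eq_right hxy] at hy
  have : k * ((y : ℝ) - μ) ^ 2 = 0 := by linarith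
  have := (mul_eq_zero.1 this).resolve_left hk.ne'
  linarith [pow_eq_zero_iff (two_ne_zero) |>.1 this]

/-- No posterior can exceed the belief `1`, so any information about the second sender is a pure
cost. -/
lemma Offer.ae_eq_prior_of_one {q : Offer μ} (hk : 0 < k)
    (h : 1 ≤ secondVisitPayoff k μ 1 q) :
    ∀ᵐ y : unitInterval ∂q.law, (y : ℝ) = μ := by
  have := q.ae_eq_line (C := 1) (s := 0)
    (integrable_of_continuous (continuous_secondVisit_integrand k μ (1 : unitInterval))) (by
      refine Filter.Eventually.of_forall fun y => ?_
      rw [max_eq_left (by simpa using y.2.2)]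
      have : 0 ≤ k * ((y : ℝ) - μ) ^ 2 := by positivity
      simp only [Set.Icc.coe_one]
      linarith) h
  filter_upwards [this] with y hy
  rw [max_eq_left (by simpa using y.2.2)] at hy
  simp only [Set.Icc.coe_one] at hy
  have : k * ((y : ℝ) - μ) ^ 2 = 0 := by linarith
  have := (mul_eq_zero.1 this).resolve_left hk.ne'
  linarith [pow_eq_zero_iff (two_ne_zero) |>.1 this]

end


/-! ### Selection probabilities and the receiver's first-best value -/

lemma other_other (i : Fin 2) : other (other i) = i := by
  fin_cases i <;> rfl

lemma other_ne (i : Fin 2) : other i ≠ i := by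
  fin_cases i <;> decide

lemma measurable_pickFirst (t : unitInterval) (x : ℝ) : Measurable (pickFirst t x) := by
  unfold pickFirst
  exact Measurable.ite (measurableSet_lt measurable_id measurable_const) measurable_const
    (Measurable.ite (measurableSet_lt measurable_const measurable_id) measurable_const
      measurable_const)

lemma pickFirst_of_lt (t : unitInterval) {x y : ℝ} (h : y < x) : pickFirst t x y = 1 := by
  simp [pickFirst, h]

lemma pickFirst_of_gt (t : unitInterval) {x y : ℝ} (h : x < y) : pickFirst t x y = 0 := by
  simp [pickFirst, h, h.le]

lemma pickFirst_nonneg (t : unitInterval) (x y : ℝ) : 0 ≤ pickFirst t x y := by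
  unfold pickFirst
  split_ifs
  exacts [zero_le_one, le_rfl, t.2.1]

lemma pickFirst_le_one (t : unitInterval) (x y : ℝ) : pickFirst t x y ≤ 1 := by
  unfold pickFirst
  split_ifs
  exacts [le_rfl, zero_le_one, t.2.2]

section

variable {k μ : ℝ}

lemma integral_pickFirst_binaryOffer (t : unitInterval) {x : ℝ} {l h : unitInterval}
    (hl : (l : ℝ) < μ) (hh : μ < h) (hlx : (l : ℝ) < x) (hxh : x < h) :
    ∫ y : unitInterval, pickFirst t x y ∂(binaryOffer l h hl hh).law = (h - μ) / (h - l) := by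
  rw [integral_binaryOffer, pickFirst_of_lt t hlx, pickFirst_of_gt t hxh]
  ring

/-- Full information as an offer. -/
def fullInfo (hμ0 : 0 < μ) (hμ1 : μ < 1) : Offer μ :=
  binaryOffer 0 1 (by simpa using hμ0) (by simpa using hμ1)

lemma isFullInformation_iff (hμ0 : 0 < μ) (hμ1 : μ < 1) (p : Offer μ) :
    IsFullInformation p ↔ p = fullInfo hμ0 hμ1 := by
  have h : (fullInfo hμ0 hμ1).law =
      ENNReal.ofReal (1 - μ) • Measure.dirac 0 + ENNReal.ofReal μ • Measure.dirac 1 := by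
    rw [fullInfo, binaryOffer_law]
    simp
  constructor
  · intro hp
    refine Offer.ext_law ?_
    rw [h]
    exact hp
  · rintro rfl
    exact h

lemma isGarbling_fullInfo (hμ0 : 0 < μ) (hμ1 : μ < 1) (q : Offer μ) :
    IsGarbling q (fullInfo hμ0 hμ1) :=
  isGarbling_binaryOffer _ _ (Filter.Eventually.of_forall fun x => ⟨x.2.1, x.2.2⟩)

namespace ReceiverStrategy

variable (σ : ReceiverStrategy k μ)

lemma measurable_continuationPayoff (i : Fin 2) (p : Offer μ) :
    Measurable fun x => σ.continuationPayoff i x p := by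
  unfold continuationPayoff
  exact Measurable.ite (σ.measurable_visitSecond i) (σ.measurable_receiver i p)
    (measurable_subtype_coe.max measurable_const)

lemma abs_continuationPayoff_le (hk : 0 < k) (hμ0 : 0 < μ) (hμ1 : μ < 1) (i : Fin 2)
    (x : unitInterval) (p : Offer μ) : |σ.continuationPayoff i x p| ≤ 1 + k := by
  unfold continuationPayoff
  split_ifs
  · exact abs_secondVisitPayoff_le hk hμ0 hμ1 _ _
  · rw [abs_of_nonneg (le_max_of_le_right hμ0.le)]
    have := max_le x.2.2 hμ1.le
    linarith

lemma integrable_continuationPayoff (hk : 0 < k) (hμ0 : 0 < μ) (hμ1 : μ < 1) (i : Fin 2)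
    (q p : Offer μ) : Integrable (fun x => σ.continuationPayoff i x p) q.law :=
  integrable_of_measurable_of_bounded (σ.measurable_continuationPayoff i p)
    fun x => σ.abs_continuationPayoff_le hk hμ0 hμ1 i x p

lemma continuationPayoff_of_mem {i : Fin 2} {x : unitInterval} {p : Offer μ}
    (h : x ∈ σ.visitSecond i) :
    σ.continuationPayoff i x p = secondVisitPayoff k μ x (σ.garbleSecond i x p) := if_pos h

lemma continuationPayoff_of_notMem {i : Fin 2} {x : unitInterval} {p : Offer μ}
    (h : x ∉ σ.visitSecond i) : σ.continuationPayoff i x p = max (x : ℝ) μ := if_neg h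

lemma pickFirstAfter_of_mem {i : Fin 2} {x : unitInterval} {p : Offer μ}
    (h : x ∈ σ.visitSecond i) : σ.pickFirstAfter i x p =
      ∫ y : unitInterval, pickFirst (σ.tieVisited i x p) x y ∂(σ.garbleSecond i x p).law := if_pos h

lemma pickFirstAfter_of_notMem {i : Fin 2} {x : unitInterval} {p : Offer μ}
    (h : x ∉ σ.visitSecond i) :
    σ.pickFirstAfter i x p = pickFirst (σ.tieUnvisited i) x μ := if_neg h

lemma pickFirstAfter_nonneg (i : Fin 2) (x : unitInterval) (p : Offer μ) :
    0 ≤ σ.pickFirstAfter i x p := by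
  unfold pickFirstAfter
  split_ifs
  · exact integral_nonneg fun y => pickFirst_nonneg _ _ _
  · exact pickFirst_nonneg _ _ _

lemma pickFirstAfter_le_one (i : Fin 2) (x : unitInterval) (p : Offer μ) :
    σ.pickFirstAfter i x p ≤ 1 := by
  unfold pickFirstAfter
  split_ifs
  · have hint : Integrable (fun y : unitInterval => pickFirst (σ.tieVisited i x p) x y)
        (σ.garbleSecond i x p).law := by
      refine integrable_of_measurable_of_bounded (C := 1)
        ((measurable_pickFirst _ _).comp measurable_subtype_coe) fun y => ?_
      rw [abs_of_nonneg (pickFirst_nonneg _ _ _)]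
      exact pickFirst_le_one _ _ _
    refine (integral_mono hint (integrable_const 1) fun y => pickFirst_le_one _ _ _).trans ?_
    simp
  · exact pickFirst_le_one _ _ _

/-- The probability with which sender `i` is visited first if `r` is that for sender `0`. -/
def firstWeight (r : unitInterval) (i : Fin 2) : ℝ := if i = 0 then (r : ℝ) else 1 - r

lemma firstWeight_nonneg (r : unitInterval) (i : Fin 2) : 0 ≤ firstWeight r i := by
  unfold firstWeight
  split_ifs
  exacts [r.2.1, sub_nonneg.2 r.2.2]

lemma firstWeight_add (r : unitInterval) (i : Fin 2) :
    firstWeight r i + firstWeight r (other i) = 1 := by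
  fin_cases i <;> simp [firstWeight, other]

lemma payoffFrom_some (p : Fin 2 → Offer μ) (r : unitInterval) (i : Fin 2) :
    σ.payoffFrom p (some r) =
      firstWeight r i * σ.firstVisitPayoff i (σ.garbleFirst i (p i)) (p (other i)) +
      firstWeight r (other i) *
        σ.firstVisitPayoff (other i) (σ.garbleFirst (other i) (p (other i))) (p i) := by
  fin_cases i
  · simp [payoffFrom, firstWeight, other]
  · simp [payoffFrom, firstWeight, other]
    ring

lemma senderPayoff_eq (p : Fin 2 → Offer μ) {r : unitInterval} (hr : σ.start = some r)
    (i : Fin 2) : σ.senderPayoff (other i) p =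
      firstWeight r (other i) * σ.pickedWhenFirst (other i) p +
        firstWeight r i * (1 - σ.pickedWhenFirst i p) := by
  fin_cases i
  · simp [senderPayoff, pickZero, hr, firstWeight, other]
    ring
  · simp [senderPayoff, pickZero, hr, firstWeight, other]

end ReceiverStrategy

/-- The receiver's value of drawing her first belief from `q` if every offer is feasible at the
second sender. -/
def firstVisitValue (k : ℝ) (q : Offer μ) : ℝ :=
  ∫ x : unitInterval, (secondVisitValue k μ x - k * ((x : ℝ) - μ) ^ 2) ∂q.law

lemma firstVisitValue_priorOffer (hμ0 : 0 ≤ μ) (hμ1 : μ ≤ 1) :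
    firstVisitValue k (priorOffer hμ0 hμ1) = secondVisitValue k μ μ := by
  rw [firstVisitValue, integral_priorOffer]
  simp

lemma exists_isUpperLine (hμ0 : 0 < μ) (hμ1 : μ < 1) {v : ℝ} (hv : ∀ q : Offer μ, firstVisitValue k q ≤ v) :
    ∃ s, IsUpperLine k μ (secondVisitValue k μ) v s := by
  refine exists_upper_line hμ0 hμ1 ?_ ?_
  · have := hv (priorOffer hμ0.le hμ1.le)
    rw [firstVisitValue_priorOffer] at this
    simpa using this
  · intro a b ha0 haμ hμb hb1
    have h := hv (binaryOffer ⟨a, ha0, by linarith⟩ ⟨b, by linarith, hb1⟩ haμ hμb)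
    rw [firstVisitValue, integral_binaryOffer] at h
    have h1 : 0 < b - a := by linarith
    have h2 := mul_le_mul_of_nonneg_left h h1.le
    refine le_trans (le_of_eq ?_) h2
    simp only
    field_simp

/-- `σ` responds optimally to full information at the second sender. -/
def ReceiverStrategy.SolvesSecond (σ : ReceiverStrategy k μ) (hμ0 : 0 < μ) (hμ1 : μ < 1) : Prop :=
  ∀ i x, IsBestSecond k x (σ.garbleSecond i x (fullInfo hμ0 hμ1))

/-- Subgame perfection applies to the offer of full information even off path. Any equilibrium
therefore supplies maximisers for the unrestricted second-visit problem, together with the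
measurability of its value. -/
lemma IsEquilibrium.solvesSecond {p : Fin 2 → Offer μ} {σ : ReceiverStrategy k μ}
    (h : IsEquilibrium k μ p σ) (hμ0 : 0 < μ) (hμ1 : μ < 1) : σ.SolvesSecond hμ0 hμ1 :=
  fun i x q => h.garbleSecond_optimal i x _ q (isGarbling_fullInfo hμ0 hμ1 q)

lemma Offer.integrable_cost (k : ℝ) (q : Offer μ) :
    Integrable (fun x : unitInterval => k * ((x : ℝ) - μ) ^ 2) q.law :=
  integrable_of_continuous (by fun_prop)

namespace ReceiverStrategy.SolvesSecond

variable {σ : ReceiverStrategy k μ} {hμ0 : 0 < μ} {hμ1 : μ < 1}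

lemma value (hσ : σ.SolvesSecond hμ0 hμ1) (hk : 0 < k) : IsSecondVisitValue k μ (secondVisitValue k μ) :=
  isSecondVisitValue hk hμ0 hμ1 fun x => ⟨_, hσ 0 x⟩

lemma measurable_value (hσ : σ.SolvesSecond hμ0 hμ1) : Measurable fun x : unitInterval => secondVisitValue k μ x := by
  have := σ.measurable_receiver 0 (fullInfo hμ0 hμ1)
  convert this using 2 with x
  exact (hσ 0 x).payoff_eq.symm

lemma payoff_le (hσ : σ.SolvesSecond hμ0 hμ1) (x : unitInterval) (q : Offer μ) :
    secondVisitPayoff k μ x q ≤ secondVisitValue k μ x := by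
  rw [← (hσ 0 x).payoff_eq]
  exact hσ 0 x q

lemma integrable_value (hσ : σ.SolvesSecond hμ0 hμ1) (hk : 0 < k) (q : Offer μ) :
    Integrable (fun x : unitInterval => secondVisitValue k μ x) q.law := by
  refine integrable_of_measurable_of_bounded hσ.measurable_value (C := 1 + k) fun x => ?_
  rw [← (hσ 0 x).payoff_eq]
  exact abs_secondVisitPayoff_le hk hμ0 hμ1 _ _

lemma continuationPayoff_le (hσ : σ.SolvesSecond hμ0 hμ1) (hk : 0 < k) (τ : ReceiverStrategy k μ) (i : Fin 2)
    (x : unitInterval) (p : Offer μ) : τ.continuationPayoff i x p ≤ secondVisitValue k μ x := by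
  by_cases h : x ∈ τ.visitSecond i
  · rw [τ.continuationPayoff_of_mem h]
    exact hσ.payoff_le _ _
  · rw [τ.continuationPayoff_of_notMem h]
    exact (hσ.value hk).max_le x x.2.1 x.2.2

lemma firstVisitPayoff_le (hσ : σ.SolvesSecond hμ0 hμ1) (hk : 0 < k) (τ : ReceiverStrategy k μ) (i : Fin 2) (q p : Offer μ) :
    τ.firstVisitPayoff i q p ≤ firstVisitValue k q :=
  integral_mono
    ((τ.integrable_continuationPayoff hk hμ0 hμ1 i q p).sub (q.integrable_cost k))
    ((hσ.integrable_value hk q).sub (q.integrable_cost k))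
    fun x => sub_le_sub_right (hσ.continuationPayoff_le hk τ i x p) _

lemma firstVisitValue_le_of_continuationPayoff (hσ : σ.SolvesSecond hμ0 hμ1) (hk : 0 < k) (τ : ReceiverStrategy k μ) (i : Fin 2)
    (q p : Offer μ) (h : ∀ x : unitInterval, secondVisitValue k μ x ≤ τ.continuationPayoff i x p) :
    firstVisitValue k q ≤ τ.firstVisitPayoff i q p :=
  integral_mono ((hσ.integrable_value hk q).sub (q.integrable_cost k))
    ((τ.integrable_continuationPayoff hk hμ0 hμ1 i q p).sub (q.integrable_cost k))
    fun x => sub_le_sub_right (h x) _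

lemma continuationPayoff_ae_eq (hσ : σ.SolvesSecond hμ0 hμ1) (hk : 0 < k) (τ : ReceiverStrategy k μ) (i : Fin 2)
    (q p : Offer μ) (h : firstVisitValue k q ≤ τ.firstVisitPayoff i q p) :
    ∀ᵐ x : unitInterval ∂q.law, τ.continuationPayoff i x p = secondVisitValue k μ x := by
  have i1 := (τ.integrable_continuationPayoff hk hμ0 hμ1 i q p).sub (q.integrable_cost k)
  have i2 := (hσ.integrable_value hk q).sub (q.integrable_cost k)
  have hle : (fun x : unitInterval => τ.continuationPayoff i x p - k * ((x : ℝ) - μ) ^ 2)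
      ≤ᵐ[q.law] fun x => secondVisitValue k μ x - k * ((x : ℝ) - μ) ^ 2 :=
    Filter.Eventually.of_forall
      fun x => sub_le_sub_right (hσ.continuationPayoff_le hk τ i x p) _
  have := (integral_eq_iff_of_ae_le i1 i2 hle).1
    (le_antisymm (hσ.firstVisitPayoff_le hk τ i q p) h)
  filter_upwards [this] with x hx
  exact sub_left_injective hx

lemma prior_le_value (hσ : σ.SolvesSecond hμ0 hμ1) (hk : 0 < k) : μ ≤ secondVisitValue k μ μ :=
  (le_max_right _ _).trans ((hσ.value hk).max_le μ hμ0.le hμ1.le)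

lemma receiverPayoff_le (hσ : σ.SolvesSecond hμ0 hμ1) (hk : 0 < k) {v : ℝ} (hv : ∀ q : Offer μ, firstVisitValue k q ≤ v)
    (p : Fin 2 → Offer μ) (τ : ReceiverStrategy k μ) : τ.receiverPayoff p ≤ v := by
  unfold ReceiverStrategy.receiverPayoff
  cases τ.start with
  | none =>
    have := hv (priorOffer hμ0.le hμ1.le)
    rw [firstVisitValue_priorOffer] at this
    exact (hσ.prior_le_value hk).trans this
  | some r =>
    rw [τ.payoffFrom_some p r 0]
    have h0 := (hσ.firstVisitPayoff_le hk τ 0 (τ.garbleFirst 0 (p 0)) (p (other 0))).trans (hv _)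
    have h1 := (hσ.firstVisitPayoff_le hk τ (other 0) (τ.garbleFirst (other 0) (p (other 0)))
      (p 0)).trans (hv _)
    have := mul_le_mul_of_nonneg_left h0 (firstWeight_nonneg r 0)
    have := mul_le_mul_of_nonneg_left h1 (firstWeight_nonneg r (other 0))
    have h2 : v = firstWeight r 0 * v + firstWeight r (other 0) * v := by
      rw [← add_mul, firstWeight_add, one_mul]
    linarith

/-- Visit sender `0` first, respond to offers at the first sender by `g`, and respond optimally
to full information at the second sender. -/
def strategy (hσ : σ.SolvesSecond hμ0 hμ1) (g : Offer μ → Offer μ) (hg : ∀ p, IsGarbling (g p) p) : ReceiverStrategy k μ where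
  start := some 1
  blindPick := 0
  garbleFirst _ := g
  garbleFirst_feasible _ := hg
  -- The inequality is strict, so she stops when indifferent; the constructed equilibrium needs this
  -- after both of its posteriors.
  visitSecond _ := {x | max (x : ℝ) μ < secondVisitValue k μ x}
  garbleSecond := σ.garbleSecond
  garbleSecond_feasible := σ.garbleSecond_feasible
  tieVisited := σ.tieVisited
  tieUnvisited _ := 0
  measurable_visitSecond _ :=
    measurableSet_lt (measurable_subtype_coe.max measurable_const) hσ.measurable_value
  measurable_receiver := σ.measurable_receiver
  measurable_sender := σ.measurable_sender

variable {g : Offer μ → Offer μ} {hg : ∀ p, IsGarbling (g p) p}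

lemma strategy_continuationPayoff (hσ : σ.SolvesSecond hμ0 hμ1) (hk : 0 < k) (i : Fin 2) (x : unitInterval) :
    (hσ.strategy g hg).continuationPayoff i x (fullInfo hμ0 hμ1) = secondVisitValue k μ x := by
  by_cases h : x ∈ (hσ.strategy g hg).visitSecond i
  · rw [ReceiverStrategy.continuationPayoff_of_mem _ h]
    exact (hσ i x).payoff_eq
  · rw [ReceiverStrategy.continuationPayoff_of_notMem _ h]
    exact le_antisymm ((hσ.value hk).max_le x x.2.1 x.2.2) (not_lt.1 h)

lemma strategy_firstVisitPayoff (hσ : σ.SolvesSecond hμ0 hμ1) (hk : 0 < k) (i : Fin 2) (q : Offer μ) :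
    (hσ.strategy g hg).firstVisitPayoff i q (fullInfo hμ0 hμ1) = firstVisitValue k q := by
  unfold ReceiverStrategy.firstVisitPayoff firstVisitValue
  simp only [hσ.strategy_continuationPayoff hk]
  rfl

/-- When both senders offer full information, the receiver can draw `q` at the first sender and
continue optimally. -/
lemma firstVisitValue_le_firstBest (hσ : σ.SolvesSecond hμ0 hμ1) (hk : 0 < k) {v : ℝ} (hv : IsFirstBestPayoff k μ v)
    (q : Offer μ) : firstVisitValue k q ≤ v := by
  classical
  let g : Offer μ → Offer μ := fun p => if p = fullInfo hμ0 hμ1 then q else p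
  have hg : ∀ p, IsGarbling (g p) p := by
    intro p
    by_cases hp : p = fullInfo hμ0 hμ1
    · simp only [g, if_pos hp]
      rw [hp]
      exact isGarbling_fullInfo hμ0 hμ1 q
    · simp only [g, if_neg hp]
      exact IsGarbling.refl p
  refine hv.1 ⟨fun _ => fullInfo hμ0 hμ1, hσ.strategy g hg, ?_⟩
  have h1 : (hσ.strategy g hg).receiverPayoff (fun _ => fullInfo hμ0 hμ1) =
      (hσ.strategy g hg).payoffFrom (fun _ => fullInfo hμ0 hμ1) (some 1) := rfl
  rw [h1, ReceiverStrategy.payoffFrom_some _ _ _ 0]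
  simp only [hσ.strategy_firstVisitPayoff hk]
  have h2 : (hσ.strategy g hg).garbleFirst 0 (fullInfo hμ0 hμ1) = q := if_pos rfl
  rw [h2]
  simp [ReceiverStrategy.firstWeight, other]

lemma ae_touches (hσ : σ.SolvesSecond hμ0 hμ1) (hk : 0 < k) {v s : ℝ} (hL : IsUpperLine k μ (secondVisitValue k μ) v s)
    {q : Offer μ} (hq : v ≤ firstVisitValue k q) :
    ∀ᵐ x : unitInterval ∂q.law, Touches k μ (secondVisitValue k μ) v s x := by
  have := q.ae_eq_line ((hσ.integrable_value hk q).sub (q.integrable_cost k))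
    (Filter.Eventually.of_forall fun x : unitInterval => hL x x.2.1 x.2.2) hq
  filter_upwards [this] with x hx using ⟨x.2.1, x.2.2, hx⟩

end ReceiverStrategy.SolvesSecond

/-- An equilibrium with full information gives the receiver her first-best payoff. -/
theorem IsEquilibrium.isFirstBestPayoff_of_fullInfo (hk : 0 < k) (hμ0 : 0 < μ) (hμ1 : μ < 1)
    {p : Fin 2 → Offer μ} {σ : ReceiverStrategy k μ} (h : IsEquilibrium k μ p σ)
    (hp : ∀ i, IsFullInformation (p i)) : IsFirstBestPayoff k μ (σ.receiverPayoff p) := by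
  have hσ := h.solvesSecond hμ0 hμ1
  have hp' : ∀ i, p i = fullInfo hμ0 hμ1 := fun i => (isFullInformation_iff hμ0 hμ1 _).1 (hp i)
  refine ⟨?_, fun w hw => hw ⟨p, σ, rfl⟩⟩
  rintro _ ⟨p', σ', rfl⟩
  refine hσ.receiverPayoff_le hk (fun q => ?_) p' σ'
  have h1 : firstVisitValue k q ≤ σ.firstVisitPayoff 0 q (p (other 0)) := by
    refine hσ.firstVisitValue_le_of_continuationPayoff hk σ 0 q _ fun x => ?_
    have := (h.visitSecond_optimal 0 x).2
    rw [hp'] at this ⊢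
    rwa [(hσ 0 x).payoff_eq] at this
  have h2 := h.garbleFirst_optimal 0 (p 0) q (by rw [hp']; exact isGarbling_fullInfo hμ0 hμ1 q)
  -- `some 1` visits sender `0` with probability one.
  have h3 := h.start_optimal (some 1)
  rw [σ.payoffFrom_some p 1 0] at h3
  simp only [ReceiverStrategy.firstWeight, other] at h3
  simp at h3
  exact (h1.trans h2).trans h3

end


/-! ### Construction of the full-information equilibrium -/

section

variable {k μ : ℝ}

/-- A small symmetric spread of size `ε` gains an amount linear in `ε` and costs only `k ε ^ 2`. -/
lemma IsSecondVisitValue.prior_lt {V : ℝ → ℝ} (hk : 0 < k) (hμ0 : 0 < μ) (hμ1 : μ < 1)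
    (hV : IsSecondVisitValue k μ V) : μ < V μ := by
  obtain ⟨ε, hε0, hε⟩ : ∃ ε, 0 < ε ∧ ε ≤ μ ∧ ε ≤ 1 - μ ∧ ε ≤ 1 / (4 * k) := by
    refine ⟨min μ (min (1 - μ) (1 / (4 * k))), ?_, min_le_left _ _,
      (min_le_right _ _).trans (min_le_left _ _), (min_le_right _ _).trans (min_le_right _ _)⟩
    exact lt_min hμ0 (lt_min (by linarith) (by positivity))
  obtain ⟨h1, h2, h3⟩ := hε
  rw [le_div_iff₀ (by linarith)] at h3
  have h := hV.twoPoint_le μ (μ - ε) (μ + ε) hμ0.le hμ1.le (by linarith) (by linarith)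
    (by linarith) (by linarith)
  rw [max_eq_left (by linarith), max_eq_right (by linarith)] at h
  refine lt_of_mul_lt_mul_left (a := 2 * ε) ?_ (by linarith)
  nlinarith [mul_pos hε0 hε0]

/-- If it is optimal not to learn at the first sender, the optimal pair at the second one is
symmetric around the prior, and no second visit is needed after either of its posteriors. -/
lemma LearningPair.symmetric_of_touches_prior {V : ℝ → ℝ} {v s a b : ℝ} (hk : 0 < k)
    (hV : IsSecondVisitValue k μ V) (hL : IsUpperLine k μ V v s) (hv : V μ = v)
    (h : LearningPair k μ V μ a b) : b - μ = μ - a ∧ V a = μ ∧ V b = b := by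
  have ha0 := h.nonneg
  have hb1 := h.le_one
  have haμ := h.left_lt
  have hμb := h.lt_right
  have ht : Touches k μ V v s μ := ⟨by linarith, by linarith, by rw [hv]; ring⟩
  have hs := h.slope_eq hk hV hL ht
  have hval := h.value
  rw [hv] at hval
  have hA := hL a ha0 (by linarith)
  have hB := hL b (by linarith) hb1
  have hA' := (le_max_right _ _).trans (hV.max_le a ha0 (by linarith))
  have hB' := (le_max_left _ _).trans (hV.max_le b (by linarith) hb1)
  have hu := sub_pos.2 haμ
  have hw := sub_pos.2 hμb
  -- Drawing the same pair at the first sender and then stopping also yields `v`, so the line must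
  -- be met at both posteriors. Its slope there, compared with the slope at `μ`, gives the symmetry.
  have eA : V a - k * (a - μ) ^ 2 = v + s * (a - μ) ∧ V a = μ := by
    have : (b - μ) * (v + s * (a - μ)) ≤ (b - μ) * (μ - k * (a - μ) ^ 2) := by
      nlinarith
    have := le_of_mul_le_mul_left this hw
    constructor <;> linarith
  have eB : V b - k * (b - μ) ^ 2 = v + s * (b - μ) ∧ V b = b := by
    have : (μ - a) * (v + s * (b - μ)) ≤ (μ - a) * (b - k * (b - μ) ^ 2) := by
      nlinarith
    have := le_of_mul_le_mul_left this hu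
    constructor <;> linarith
  refine ⟨?_, eA.2, eB.2⟩
  have h1 := eA.1
  have h2 := eB.1
  rw [eA.2] at h1
  rw [eB.2] at h2
  have h3 : k * (b - a) * ((b - μ) - (μ - a)) = 0 := by linear_combination h1 - h2 - hs
  have h4 : 0 < k * (b - a) := by
    have : 0 < b - a := by linarith
    positivity
  linarith [(mul_eq_zero.1 h3).resolve_left h4.ne']

/-- If visiting a single sender is optimal under full information, there is an equilibrium with
full information. -/
theorem exists_fullInfo_equilibrium (hk : 0 < k) (hμ0 : 0 < μ) (hμ1 : μ < 1)
    {σ : ReceiverStrategy k μ} (hσ : σ.SolvesSecond hμ0 hμ1)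
    (hsecond : ∀ (i : Fin 2) (x : unitInterval) (p' q : Offer μ), IsGarbling q p' →
      secondVisitPayoff k μ x q ≤ secondVisitPayoff k μ x (σ.garbleSecond i x p'))
    (hv : ∀ q : Offer μ, firstVisitValue k q ≤ secondVisitValue k μ μ) :
    ∃ (p : Fin 2 → Offer μ) (σ : ReceiverStrategy k μ),
      IsEquilibrium k μ p σ ∧ ∀ i, IsFullInformation (p i) := by
  classical
  have hV := hσ.value hk
  obtain ⟨s, hL⟩ := exists_isUpperLine hμ0 hμ1 hv
  set m : unitInterval := ⟨μ, hμ0.le, hμ1.le⟩ with hm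
  rcases (hσ 0 m).eq_or_binaryOffer hk hμ0 hμ1 with h | ⟨a, b, ha, hb, hpair, hQ⟩
  · rw [show (m : ℝ) = μ from rfl, max_self] at h
    linarith [hV.prior_lt hk hμ0 hμ1]
  rw [show (m : ℝ) = μ from rfl] at hpair
  obtain ⟨hsym, hVa, hVb⟩ := hpair.symmetric_of_touches_prior hk hV hL rfl
  have hab : 0 < (b : ℝ) - a := by linarith
  have w1 : ((b : ℝ) - μ) / (b - a) = 1 / 2 := by
    rw [div_eq_iff hab.ne']; linarith
  have w2 : (μ - (a : ℝ)) / (b - a) = 1 / 2 := by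
    rw [div_eq_iff hab.ne']; linarith
  -- A first sender who withholds information is punished by learning nothing about him. This costs
  -- the receiver nothing, as learning at the second sender alone also yields `v`.
  let g : Offer μ → Offer μ := fun p =>
    if p = fullInfo hμ0 hμ1 then binaryOffer a b ha hb else priorOffer hμ0.le hμ1.le
  have hgF : g (fullInfo hμ0 hμ1) = binaryOffer a b ha hb := if_pos rfl
  have hgN : ∀ p, p ≠ fullInfo hμ0 hμ1 → g p = priorOffer hμ0.le hμ1.le := fun p hp => if_neg hp
  have hg : ∀ p, IsGarbling (g p) p := by
    intro p
    by_cases hp : p = fullInfo hμ0 hμ1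
    · rw [hp]; exact isGarbling_fullInfo hμ0 hμ1 _
    · rw [hgN p hp]; exact isGarbling_priorOffer _ _ p
  have hgv : ∀ p, firstVisitValue k (g p) = secondVisitValue k μ μ := by
    intro p
    by_cases hp : p = fullInfo hμ0 hμ1
    · rw [hp, hgF, firstVisitValue, integral_binaryOffer, hVa, hVb]
      have := hpair.value
      refine mul_left_cancel₀ hab.ne' ?_
      rw [this]
      field_simp
      ring
    · rw [hgN p hp, firstVisitValue_priorOffer]
  set τ := hσ.strategy g hg with hτ
  have hcont : ∀ i x, τ.continuationPayoff i x (fullInfo hμ0 hμ1) = secondVisitValue k μ x :=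
    fun i x => hσ.strategy_continuationPayoff hk i x
  have hfirst : ∀ i q, τ.firstVisitPayoff i q (fullInfo hμ0 hμ1) = firstVisitValue k q :=
    fun i q => hσ.strategy_firstVisitPayoff hk i q
  have hstart : ∀ r, τ.payoffFrom (fun _ => fullInfo hμ0 hμ1) (some r) =
      secondVisitValue k μ μ := by
    intro r
    rw [τ.payoffFrom_some _ r 0, hfirst, hfirst]
    have e : ∀ i, firstVisitValue k (τ.garbleFirst i (fullInfo hμ0 hμ1)) =
        secondVisitValue k μ μ := fun i => hgv _
    rw [e, e, ← add_mul, ReceiverStrategy.firstWeight_add, one_mul]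
  -- A unilateral deviation leaves one sender at full information. If sender `0` offers it, she
  -- learns there and stops; otherwise she learns at sender `1`.
  have hpick : ∀ p : Fin 2 → Offer μ, (p 0 = fullInfo hμ0 hμ1 ∨ p 1 = fullInfo hμ0 hμ1) →
      τ.pickZero p = 1 / 2 := by
    intro p hp
    have h1 : τ.pickZero p = τ.pickedWhenFirst 0 p := by
      have : τ.pickZero p = ((1 : unitInterval) : ℝ) * τ.pickedWhenFirst 0 p +
        (1 - ((1 : unitInterval) : ℝ)) * (1 - τ.pickedWhenFirst 1 p) := rfl
      rw [this]
      simp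
    rw [h1, ReceiverStrategy.pickedWhenFirst, show τ.garbleFirst 0 (p 0) = g (p 0) from rfl]
    by_cases hp0 : p 0 = fullInfo hμ0 hμ1
    · rw [hp0, hgF, integral_binaryOffer, w1, w2]
      have na : a ∉ τ.visitSecond 0 := by
        have : max (a : ℝ) μ = secondVisitValue k μ a := by rw [hVa, max_eq_right ha.le]
        exact fun h => (this.not_lt h)
      have nb : b ∉ τ.visitSecond 0 := by
        have : max (b : ℝ) μ = secondVisitValue k μ b := by rw [hVb, max_eq_left hb.le]
        exact fun h => (this.not_lt h)
      rw [τ.pickFirstAfter_of_notMem na, τ.pickFirstAfter_of_notMem nb, pickFirst_of_gt _ ha,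
        pickFirst_of_lt _ hb]
      norm_num
    · have hp1 := hp.resolve_left hp0
      rw [hgN _ hp0, integral_priorOffer, show other 0 = 1 from rfl, hp1]
      have hmem : m ∈ τ.visitSecond 0 := by
        show max μ μ < secondVisitValue k μ μ
        rw [max_self]
        exact hV.prior_lt hk hμ0 hμ1
      rw [τ.pickFirstAfter_of_mem hmem]
      rw [show τ.garbleSecond 0 m (fullInfo hμ0 hμ1) = binaryOffer a b ha hb from hQ,
        integral_pickFirst_binaryOffer _ ha hb ha hb, w1]
  refine ⟨fun _ => fullInfo hμ0 hμ1, τ, ?_, fun i => (isFullInformation_iff hμ0 hμ1 _).2 rfl⟩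
  refine ⟨?_, ?_, ?_, ?_, hsecond⟩
  · intro i p'
    have e1 := hpick (fun _ => fullInfo hμ0 hμ1) (Or.inl rfl)
    have e2 : τ.pickZero (Function.update (fun _ => fullInfo hμ0 hμ1) i p') = 1 / 2 := by
      refine hpick _ ?_
      fin_cases i
      · right; simp
      · left; simp
    unfold ReceiverStrategy.senderPayoff
    rw [e1, e2]
  · intro r
    rw [show τ.start = some 1 from rfl, hstart]
    cases r with
    | none => exact hσ.prior_le_value hk
    | some r => exact (hstart r).le
  · intro i p' q _
    rw [hfirst, hfirst, show τ.garbleFirst i p' = g p' from rfl, hgv]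
    exact hv q
  · intro i x
    rw [hcont]
    exact ⟨hV.max_le x x.2.1 x.2.2, hσ.payoff_le x _⟩

/-- On `[0, b]` a corner solution is the only optimal garbling at the second sender. -/
lemma eq_binaryOffer_of_corner {x b : unitInterval} (hk : 0 < k) (hμ0 : 0 < μ) (hb : μ < b)
    (h0 : ((0 : unitInterval) : ℝ) < μ) (hx0 : 0 < (x : ℝ)) (hxb : (x : ℝ) < b)
    (h1 : k * (b : ℝ) ^ 2 ≤ b - x)
    (h2 : k * (b : ℝ) ^ 2 ≤ x) {g : Offer μ} (hg : IsGarbling g (binaryOffer 0 b h0 hb))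
    (hle : secondVisitPayoff k μ x (binaryOffer 0 b h0 hb) ≤ secondVisitPayoff k μ x g) :
    g = binaryOffer 0 b h0 hb := by
  have hb0 : 0 < (b : ℝ) := by linarith
  have hC := secondVisitPayoff_binaryOffer (k := k) x 0 b h0 hb
  set C := secondVisitPayoff k μ x (binaryOffer 0 b h0 hb)
  simp only [Set.Icc.coe_zero, sub_zero, zero_sub] at hC
  rw [max_eq_left hx0.le, max_eq_right hxb.le] at hC
  obtain ⟨s, hs⟩ : ∃ s, s * b = ((b : ℝ) - k * (b - μ) ^ 2) - (x - k * μ ^ 2) :=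
    ⟨(((b : ℝ) - k * (b - μ) ^ 2) - (x - k * μ ^ 2)) / b, by field_simp⟩
  -- The line through the values at `0` and `b`: its gap factors on either side of `x` and is
  -- positive on `[0, b]` away from the endpoints.
  have hlow : ∀ y : ℝ, y ≤ x → b * (C + s * (y - μ) - (max (x : ℝ) y - k * (y - μ) ^ 2)) =
      y * ((b - x) - k * (b : ℝ) ^ 2 + k * y * b) := by
    intro y hy
    rw [max_eq_left hy]
    linear_combination hC + (y - μ) * hs
  have hhigh : ∀ y : ℝ, x ≤ y → b * (C + s * (y - μ) - (max (x : ℝ) y - k * (y - μ) ^ 2)) =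
      (b - y) * (x - k * y * b) := by
    intro y hy
    rw [max_eq_right hy]
    linear_combination hC + (y - μ) * hs
  have hmem := hg.ae_mem
  have hline := g.ae_eq_line (C := C) (s := s)
    (integrable_of_continuous (continuous_secondVisit_integrand k μ x)) (by
      filter_upwards [hmem] with y hy
      refine sub_nonneg.1 (nonneg_of_mul_nonneg_right (a := (b : ℝ)) ?_ hb0)
      rcases le_total (y : ℝ) x with hyx | hyx
      · rw [hlow y hyx]
        exact mul_nonneg y.2.1 (add_nonneg (by linarith)
          (mul_nonneg (mul_nonneg hk.le y.2.1) hb0.le))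
      · rw [hhigh y hyx]
        refine mul_nonneg (by linarith) ?_
        have : k * y * b ≤ k * b * b := by gcongr; exact hy.2
        linarith) hle
  refine eq_binaryOffer h0 hb ?_
  filter_upwards [hmem, hline] with y hy hyl
  rcases le_total (y : ℝ) x with hyx | hyx
  · left
    have := hlow y hyx
    rw [hyl, sub_self, mul_zero] at this
    by_contra hne
    have hy0 : 0 < (y : ℝ) := lt_of_le_of_ne y.2.1 fun h => hne (Subtype.ext h.symm)
    have : 0 < (y : ℝ) * ((b - x) - k * (b : ℝ) ^ 2 + k * y * b) :=
      mul_pos hy0 (add_pos_of_nonneg_of_pos (by linarith) (by positivity))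
    linarith
  · right
    have := hhigh y hyx
    rw [hyl, sub_self, mul_zero] at this
    by_contra hne
    have hyb : (y : ℝ) < b := lt_of_le_of_ne hy.2 fun h => hne (Subtype.ext h)
    have : 0 < ((b : ℝ) - y) * (x - k * y * b) := by
      refine mul_pos (by linarith) ?_
      have : k * y * b < k * b * b := by gcongr
      linarith
    linarith

end


/-! ### Profitable deviations when learning about one sender is not first best -/

section

variable {k μ : ℝ}

open ReceiverStrategy

/-- In a first-best equilibrium each first visit that occurs gives the first-best payoff. -/
lemma firstVisitPayoff_eq_of_weight_pos {hμ0 : 0 < μ} {hμ1 : μ < 1} (hk : 0 < k)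
    {p : Fin 2 → Offer μ} {σ : ReceiverStrategy k μ} (hσ : σ.SolvesSecond hμ0 hμ1)
    {r : unitInterval} (hr : σ.start = some r)
    (hv : ∀ q : Offer μ, firstVisitValue k q ≤ σ.receiverPayoff p) {i : Fin 2}
    (hi : 0 < firstWeight r i) :
    σ.receiverPayoff p ≤ σ.firstVisitPayoff i (σ.garbleFirst i (p i)) (p (other i)) := by
  have h : σ.receiverPayoff p = σ.payoffFrom p (some r) := by
    rw [← hr]; rfl
  have h2 := σ.payoffFrom_some p r i
  rw [← h] at h2
  have h3 := (hσ.firstVisitPayoff_le hk σ (other i) (σ.garbleFirst (other i) (p (other i)))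
    (p i)).trans (hv _)
  have h4 := mul_le_mul_of_nonneg_left h3 (firstWeight_nonneg r (other i))
  have h5 := firstWeight_add r i
  refine le_of_mul_le_mul_left (a := firstWeight r i) ?_ hi
  have h6 : σ.receiverPayoff p = firstWeight r i * σ.receiverPayoff p +
      firstWeight r (other i) * σ.receiverPayoff p := by
    rw [← add_mul, h5, one_mul]
  linarith

/-- A sender has no deviation that leaves the receiver's behaviour at a first visit to him
unchanged and increases his chances when he is visited second. -/
lemma IsEquilibrium.not_profitable {p : Fin 2 → Offer μ} {σ : ReceiverStrategy k μ}
    (h : IsEquilibrium k μ p σ) {r : unitInterval} (hr : σ.start = some r) {i : Fin 2}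
    (hi : 0 < firstWeight r i) (p' : Offer μ)
    (hfirst : 0 < firstWeight r (other i) →
      σ.garbleFirst (other i) p' = σ.garbleFirst (other i) (p (other i))) :
    ∫ x, σ.pickFirstAfter i x (p (other i)) ∂(σ.garbleFirst i (p i)).law ≤
      ∫ x, σ.pickFirstAfter i x p' ∂(σ.garbleFirst i (p i)).law := by
  have hopt := h.sender_optimal (other i) p'
  rw [σ.senderPayoff_eq _ hr, σ.senderPayoff_eq _ hr] at hopt
  have e1 : firstWeight r (other i) *
      σ.pickedWhenFirst (other i) (Function.update p (other i) p') =
      firstWeight r (other i) * σ.pickedWhenFirst (other i) p := by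
    rcases (firstWeight_nonneg r (other i)).eq_or_lt with h0 | h0
    · rw [← h0, zero_mul, zero_mul]
    · unfold pickedWhenFirst
      rw [Function.update_self, hfirst h0, other_other,
        Function.update_of_ne (other_ne i).symm]
  have e2 : σ.pickedWhenFirst i (Function.update p (other i) p') =
      ∫ x, σ.pickFirstAfter i x p' ∂(σ.garbleFirst i (p i)).law := by
    unfold pickedWhenFirst
    rw [Function.update_self, Function.update_of_ne (other_ne i).symm]
  rw [e1, e2] at hopt
  have h3 := le_of_add_le_add_left hopt
  have h4 := le_of_mul_le_mul_left h3 hi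
  unfold pickedWhenFirst at h4
  linarith

/-- If the upper line touches in two points only, every first-best draw at the first sender is the
two-point one. -/
lemma ReceiverStrategy.SolvesSecond.eq_binaryOffer {hμ0 : 0 < μ} {hμ1 : μ < 1} (hk : 0 < k)
    {σ : ReceiverStrategy k μ} (hσ : σ.SolvesSecond hμ0 hμ1) {v s : ℝ}
    (hL : IsUpperLine k μ (secondVisitValue k μ) v s) {c e : unitInterval} (hc : (c : ℝ) < μ)
    (he : μ < e)
    (hce : ∀ x : ℝ, Touches k μ (secondVisitValue k μ) v s x → x = c ∨ x = e) {q : Offer μ}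
    (hq : v ≤ firstVisitValue k q) : q = binaryOffer c e hc he := by
  refine _root_.eq_binaryOffer hc he ?_
  filter_upwards [hσ.ae_touches hk hL hq] with x hx
  exact (hce x hx).imp Subtype.ext Subtype.ext

/-- The consequences of a first-best equilibrium in which the upper line touches in two points. -/
lemma IsEquilibrium.deviation_le {hμ0 : 0 < μ} {hμ1 : μ < 1} (hk : 0 < k)
    {p : Fin 2 → Offer μ} {σ : ReceiverStrategy k μ} (h : IsEquilibrium k μ p σ)
    {r : unitInterval} (hr : σ.start = some r)
    (hv : ∀ q : Offer μ, firstVisitValue k q ≤ σ.receiverPayoff p) {s : ℝ}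
    (hL : IsUpperLine k μ (secondVisitValue k μ) (σ.receiverPayoff p) s)
    {c e : unitInterval} (hc : (c : ℝ) < μ) (he : μ < e)
    (hce : ∀ x : ℝ, Touches k μ (secondVisitValue k μ) (σ.receiverPayoff p) s x →
      x = c ∨ x = e) {i : Fin 2} (hi : 0 < firstWeight r i) :
    σ.continuationPayoff i c (p (other i)) = secondVisitValue k μ c ∧
    σ.continuationPayoff i e (p (other i)) = secondVisitValue k μ e ∧
    ∀ p' : Offer μ, IsGarbling (binaryOffer c e hc he) p' →
      ((e : ℝ) - μ) * σ.pickFirstAfter i c (p (other i)) +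
        (μ - c) * σ.pickFirstAfter i e (p (other i)) ≤
      (e - μ) * σ.pickFirstAfter i c p' + (μ - c) * σ.pickFirstAfter i e p' := by
  have hσ := h.solvesSecond hμ0 hμ1
  have honpath : ∀ j, 0 < firstWeight r j →
      σ.garbleFirst j (p j) = binaryOffer c e hc he := fun j hj =>
    hσ.eq_binaryOffer hk hL hc he hce
      ((firstVisitPayoff_eq_of_weight_pos hk hσ hr hv hj).trans
        (hσ.firstVisitPayoff_le hk σ _ _ _))
  have hcont := hσ.continuationPayoff_ae_eq hk σ i (σ.garbleFirst i (p i)) (p (other i))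
    ((hv _).trans (firstVisitPayoff_eq_of_weight_pos hk hσ hr hv hi))
  rw [honpath i hi] at hcont
  obtain ⟨h1, h2⟩ := of_ae_binaryOffer c e hc he hcont
  refine ⟨h1, h2, fun p' hp' => ?_⟩
  have h3 := h.not_profitable hr hi p' ?_
  · rw [honpath i hi, integral_binaryOffer, integral_binaryOffer] at h3
    have hN : 0 < (e : ℝ) - c := by linarith
    have := mul_le_mul_of_nonneg_left h3 hN.le
    field_simp at this
    exact this
  -- The old draw remains feasible, so the garbling chosen under `p'` is still first best and, by
  -- uniqueness, is the same draw.
  · intro hj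
    rw [honpath _ hj]
    refine hσ.eq_binaryOffer hk hL hc he hce ?_
    have h4 := h.garbleFirst_optimal (other i) p' _ hp'
    rw [← honpath _ hj] at h4
    exact (firstVisitPayoff_eq_of_weight_pos hk hσ hr hv hj).trans
      (h4.trans (hσ.firstVisitPayoff_le hk σ _ _ _))

/-- Selection probabilities after a belief at which a second visit is strictly optimal. -/
lemma pickFirstAfter_of_learningPair {hμ0 : 0 < μ} {hμ1 : μ < 1} (hk : 0 < k)
    {σ : ReceiverStrategy k μ} (hσ : σ.SolvesSecond hμ0 hμ1) {v s : ℝ}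
    (hL : IsUpperLine k μ (secondVisitValue k μ) v s) {x : unitInterval} {a b : ℝ}
    (h : LearningPair k μ (secondVisitValue k μ) x a b)
    (ht : Touches k μ (secondVisitValue k μ) v s x) {i : Fin 2} {p : Offer μ}
    (hcont : σ.continuationPayoff i x p = secondVisitValue k μ x) :
    x ∈ σ.visitSecond i ∧ σ.pickFirstAfter i x p = (b - μ) / (b - a) := by
  have hmax := h.max_lt hk
  have hmem : x ∈ σ.visitSecond i := by
    by_contra hx
    rw [σ.continuationPayoff_of_notMem hx] at hcont
    exact hmax.ne hcont
  refine ⟨hmem, ?_⟩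
  rw [σ.continuationPayoff_of_mem hmem] at hcont
  have hbest : IsBestSecond k x (σ.garbleSecond i x p) := fun q' => by
    rw [hcont]; exact hσ.payoff_le x q'
  rcases hbest.eq_or_binaryOffer hk hμ0 hμ1 with h1 | ⟨a', b', ha', hb', h', hq⟩
  · exact absurd h1.symm hmax.ne
  · have hV := hσ.value hk
    rw [σ.pickFirstAfter_of_mem hmem, hq,
      integral_pickFirst_binaryOffer _ ha' hb' h'.left_lt h'.lt_right]
    -- The optimal pair is not known to be unique, but the slope of the line determines the
    -- probability of its lower posterior.
    have e1 := h.slope_eq hk hV hL ht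
    have e2 := h'.slope_eq hk hV hL ht
    have n1 : 0 < b - a := by linarith [h.left_lt, h.lt_right]
    have n2 : 0 < (b' : ℝ) - a' := by linarith [h'.left_lt, h'.lt_right]
    rw [div_eq_div_iff n2.ne' n1.ne']
    linear_combination (b - a) * (-e2) + ((b' : ℝ) - a') * e1

/-- A second visited sender whose posteriors exceed the belief about the first is selected if
learning about him is not worthwhile. -/
lemma IsEquilibrium.pickFirstAfter_eq_zero {hμ0 : 0 < μ} {hμ1 : μ < 1} (hk : 0 < k)
    {p : Fin 2 → Offer μ} {σ : ReceiverStrategy k μ} (h : IsEquilibrium k μ p σ) {i : Fin 2}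
    {c e : unitInterval} (hc : (c : ℝ) < μ) (he : μ < e) :
    σ.pickFirstAfter i c (binaryOffer c e hc he) = 0 := by
  by_cases hm : c ∈ σ.visitSecond i
  · rw [σ.pickFirstAfter_of_mem hm]
    have h1 := h.garbleSecond_optimal i c _ _
      (isGarbling_priorOffer hμ0.le hμ1.le (binaryOffer c e hc he))
    rw [secondVisitPayoff_priorOffer, max_eq_right hc.le] at h1
    have h2 := Offer.ae_eq_prior_of_le hk
      ((σ.garbleSecond_feasible i c (binaryOffer c e hc he)).ae_mem.mono fun y hy => hy.1) h1
    refine (integral_congr_ae (g := fun _ => (0 : ℝ)) ?_).trans (by simp)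
    filter_upwards [h2] with y hy
    rw [hy]
    exact pickFirst_of_gt _ hc
  · rw [σ.pickFirstAfter_of_notMem hm]
    exact pickFirst_of_gt _ hc

lemma pickFirstAfter_one {hμ0 : 0 < μ} {hμ1 : μ < 1} (hk : 0 < k)
    {σ : ReceiverStrategy k μ} (hσ : σ.SolvesSecond hμ0 hμ1) {i : Fin 2} {p : Offer μ}
    (hcont : σ.continuationPayoff i 1 p = secondVisitValue k μ ((1 : unitInterval) : ℝ)) :
    σ.pickFirstAfter i 1 p = 1 := by
  by_cases hm : (1 : unitInterval) ∈ σ.visitSecond i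
  · rw [σ.pickFirstAfter_of_mem hm]
    have h1 := (le_max_left _ _).trans ((hσ.value hk).max_le 1 zero_le_one le_rfl)
    rw [σ.continuationPayoff_of_mem hm] at hcont
    have h2 := Offer.ae_eq_prior_of_one hk (h1.trans hcont.ge)
    refine (integral_congr_ae (g := fun _ => (1 : ℝ)) ?_).trans (by simp)
    filter_upwards [h2] with y hy
    rw [hy]
    exact pickFirst_of_lt _ hμ1
  · rw [σ.pickFirstAfter_of_notMem hm]
    exact pickFirst_of_lt _ hμ1

/-- In a first-best equilibrium, visiting a single sender is optimal under full information. -/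
theorem IsEquilibrium.receiverPayoff_le_of_firstBest (hk : 0 < k) (hμ0 : 0 < μ) (hμ1 : μ < 1)
    {p : Fin 2 → Offer μ} {σ : ReceiverStrategy k μ} (h : IsEquilibrium k μ p σ)
    (hv : ∀ q : Offer μ, firstVisitValue k q ≤ σ.receiverPayoff p) :
    σ.receiverPayoff p ≤ secondVisitValue k μ μ := by
  by_contra! hlt
  have hσ := h.solvesSecond hμ0 hμ1
  have hV := hσ.value hk
  obtain ⟨s, hL⟩ := exists_isUpperLine hμ0 hμ1 hv
  obtain ⟨r, hr⟩ : ∃ r, σ.start = some r := by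
    cases hs : σ.start with
    | none =>
      have : σ.receiverPayoff p = μ := by
        unfold receiverPayoff
        rw [hs]; rfl
      linarith [hσ.prior_le_value hk]
    | some r => exact ⟨r, rfl⟩
  obtain ⟨i, hi⟩ : ∃ i, 0 < firstWeight r i := by
    by_contra! h0
    linarith [firstWeight_add r 0, h0 0, h0 (other 0)]
  have htouch := hσ.ae_touches hk hL
    ((firstVisitPayoff_eq_of_weight_pos hk hσ hr hv hi).trans
      (hσ.firstVisitPayoff_le hk σ _ _ _))
  obtain ⟨⟨c₀, hc₀, hc₀μ⟩, e₀, he₀, hμe₀⟩ := Offer.exists_lt_gt _ hμ0.le hμ1.le htouch (by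
    intro ht
    have := ht.2.2
    simp only [sub_self] at this
    norm_num at this
    linarith)
  rcases le_total μ (1 / 2) with hμ | hμ
  · obtain ⟨e, b, hμe, hpair, ht0, hte, hE, hlt'⟩ :=
      exists_touches_eq_of_le_half hk hμ0 hμ hV hL hlt hc₀μ hμe₀ hc₀ he₀
    obtain ⟨e, rfl⟩ : ∃ e' : unitInterval, (e' : ℝ) = e := ⟨⟨e, hte.1, hte.2.1⟩, rfl⟩
    have h0μ : ((0 : unitInterval) : ℝ) < μ := by simpa using hμ0
    obtain ⟨-, hcont, hdev⟩ := h.deviation_le (hμ0 := hμ0) (hμ1 := hμ1) hk hr hv hL h0μ hμe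
      (by simpa using hE) hi
    have hb1 := hpair.le_one
    have hright := hpair.right_le
    rw [sub_zero, sub_zero] at hright
    have hkb : 0 ≤ k * b ^ 2 := by positivity
    -- The midpoint of `e + k b ^ 2` and `b` is below `b` but leaves enough room for the corner
    -- condition `k b' ^ 2 ≤ b' - e`.
    obtain ⟨b', hb'⟩ : ∃ b' : unitInterval, (b' : ℝ) = (e + k * b ^ 2 + b) / 2 :=
      ⟨⟨(e + k * b ^ 2 + b) / 2, by linarith, by linarith⟩, rfl⟩
    have heb' : (e : ℝ) < b' := by linarith
    have hb'b : (b' : ℝ) < b := by linarith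
    have hμb' : μ < (b' : ℝ) := by linarith
    have hsq : k * (b' : ℝ) ^ 2 ≤ k * b ^ 2 := by
      have := b'.2.1
      gcongr
    have hd := hdev (binaryOffer 0 b' h0μ hμb') (isGarbling_binaryOffer _ _ (by
      filter_upwards [ae_binaryOffer 0 e h0μ hμe] with x hx
      rcases hx with rfl | rfl
      · exact ⟨le_rfl, b'.2.1⟩
      · exact ⟨x.2.1, heb'.le⟩))
    obtain ⟨hmem, hold⟩ := pickFirstAfter_of_learningPair hk hσ hL hpair hte hcont
    have hnew : σ.pickFirstAfter i e (binaryOffer 0 b' h0μ hμb') = (b' - μ) / b' := by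
      rw [σ.pickFirstAfter_of_mem hmem, eq_binaryOffer_of_corner hk hμ0 hμb' h0μ hpair.left_lt heb'
        (by linarith) (by linarith) (σ.garbleSecond_feasible i e _)
        (h.garbleSecond_optimal i e _ _ (IsGarbling.refl _)),
        integral_pickFirst_binaryOffer _ _ _ hpair.left_lt heb']
      simp
    rw [h.pickFirstAfter_eq_zero (hμ0 := hμ0) (hμ1 := hμ1) hk, hold, hnew] at hd
    have h1 := mul_nonneg (sub_nonneg.2 hμe.le) (σ.pickFirstAfter_nonneg i 0 (p (other i)))
    simp only [Set.Icc.coe_zero, sub_zero, mul_zero, zero_add] at hd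
    -- The first sender's chance `1 - μ / y` increases with the rival's upper posterior `y`, so
    -- lowering `b` to `b'` hurts him.
    have h2 : (b - μ) / b ≤ (b' - μ) / b' := by
      refine le_of_mul_le_mul_left (a := μ) ?_ hμ0
      linarith
    rw [div_le_div_iff₀ (by linarith) (by linarith)] at h2
    nlinarith
  · obtain ⟨c, a, hcμ, hpair, ht1, htc, hE⟩ :=
      exists_touches_eq_of_half_le hk hμ1 hμ hV hL hlt hc₀μ hμe₀ hc₀ he₀
    obtain ⟨c, rfl⟩ : ∃ c' : unitInterval, (c' : ℝ) = c := ⟨⟨c, htc.1, htc.2.1⟩, rfl⟩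
    have h1μ : μ < ((1 : unitInterval) : ℝ) := by simpa using hμ1
    obtain ⟨hcont, hcont1, hdev⟩ := h.deviation_le (hμ0 := hμ0) (hμ1 := hμ1) hk hr hv hL hcμ h1μ
      (by simpa using hE) hi
    -- The deviation is to the first-best draw itself: its posteriors never fall below `c`, so
    -- learning after `c` becomes worthless.
    have hd := hdev _ (IsGarbling.refl _)
    obtain ⟨-, hold⟩ := pickFirstAfter_of_learningPair hk hσ hL hpair htc hcont
    rw [h.pickFirstAfter_eq_zero (hμ0 := hμ0) (hμ1 := hμ1) hk, hold,
      pickFirstAfter_one hk hσ hcont1] at hd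
    have h1 := mul_le_mul_of_nonneg_left
      (σ.pickFirstAfter_le_one i 1 (binaryOffer c 1 hcμ h1μ)) (sub_nonneg.2 hcμ.le)
    have h2 : 0 < ((1 : unitInterval) - μ) * ((1 - μ) / (1 - a)) :=
      mul_pos (sub_pos.2 h1μ) (div_pos (by linarith) (by linarith [hpair.left_lt_prior]))
    linarith

end

end

theorem mainTheorem3 (k μ : ℝ) (hk : 0 < k) (hμ0 : 0 < μ) (hμ1 : μ < 1) :
    (∃ (p : Fin 2 → Offer μ) (σ : ReceiverStrategy k μ),
        IsEquilibrium k μ p σ ∧ IsFirstBestPayoff k μ (σ.receiverPayoff p)) ↔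
      (∃ (p : Fin 2 → Offer μ) (σ : ReceiverStrategy k μ),
        IsEquilibrium k μ p σ ∧ ∀ i, IsFullInformation (p i)) := by
  constructor
  · rintro ⟨p, σ, h, hfb⟩
    have hσ := h.solvesSecond hμ0 hμ1
    have hv := hσ.firstVisitValue_le_firstBest hk hfb
    exact exists_fullInfo_equilibrium hk hμ0 hμ1 hσ h.garbleSecond_optimal
      fun q => (hv q).trans (h.receiverPayoff_le_of_firstBest hk hμ0 hμ1 hv)
  · rintro ⟨p, σ, h, hp⟩
    exact ⟨p, σ, h, h.isFirstBestPayoff_of_fullInfo hk hμ0 hμ1 hp⟩
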